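/- **Setting.** For each sample size $n$ let $X_{1,n},\dots,X_{n,n}$ be fixed points of a predictor space $\mathcal X$; for $R\subseteq\mathcal X$ let $n_R$ be the number of $i$ with $X_{i,n}\in R$. Let $l_1,\dots,l_m$ be a partition of $\mathcal X$ (the leaves of the observed tree), and let $p_1=\mathcal X\supseteq p_2\supseteq\dots\supseteq p_d\supseteq p_{d+1}:=l_1$ be the path of regions leading to $l_1$. For $h\le d$ let $s_h^1,\dots,s_h^{k_h}$ be the candidate binary splits of $p_h$, where $s_h^k$ divides $p_h$ into $p_h^k\subseteq p_h$ and $p_h\setminus p_h^k$, and $p_h^1=p_{h+1}$; thus $s_h^1$ is the observed split. The numbers $m$, $d$, $k_h$ are fixed; the regions may depend on $n$. Write $n_1=n_{l_1}$ and $n_R^1=n_{R\cap l_1}$. The outcomes $Y_1,\dots,Y_n$ are independent, $Y_i\sim\mathrm{Bernoulli}(\theta_{i,n})$, $\theta_{i,n}=\sum_{j}\pi_{j,n}\mathbf 1[X_{i,n}\in l_j]$, with $\pi_{j,n}\in(0,1)$. For a region $R$ let $\hat\pi_R=n_R^{-1}\sum_iY_i\mathbf 1[X_{i,n}\in R]$.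 Given an impurity function $\mathcal I$, the gain of $s_h^k$ is $$G_h^k(Y)=\mathcal I(\hat\pi_{p_h})-\frac{n_{p_h^k}}{n_{p_h}}\mathcal I(\hat\pi_{p_h^k})-\frac{n_{p_h\setminus p_h^k}}{n_{p_h}}\mathcal I(\hat\pi_{p_h\setminus p_h^k}).$$ Given $Y$, splits $S_1,\dots,S_d$ at $p_1,\dots,p_d$ are drawn independently by the exponential mechanism with fixed temperature parameters $\epsilon_h$: $\mathbb P(S_h=s_h^k\mid Y)=e^{\epsilon_hG_h^k(Y)}/\sum_{k'}e^{\epsilon_hG_h^{k'}(Y)}$. **Key statistics and pivot.** Let $\hat T_{n,1}=\sqrt{n_1}\,\hat\pi_{l_1}$ and $\hat\pi_{-1}(R)=\sqrt{n_R}\,\hat\pi_R-\frac{n_R^1}{\sqrt{n_1n_R}}\hat T_{n,1}$. Let $\hat T_{n,-1}$ be the vector of all $\hat\pi_{-1}(p_h)$ and $\hat\pi_{-1}(p_h^k)$, $h\le d$, $2\le k\le k_h$, let $\hat T_n=(\hat T_{n,1},\hat T_{n,-1})$, and let $\Sigma_n=\mathrm{Cov}(\hat T_n)$, the regions being held fixed.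 The proportions $\hat\pi_R$ entering the gains are linear functions of $\hat T_n$ (namely $\hat\pi_R=\frac{n_R^1}{n_R\sqrt{n_1}}\hat T_{n,1}+\frac1{\sqrt{n_R}}\hat\pi_{-1}(R)$ for $R=p_h,p_h^k$, where $\hat\pi_{-1}(l_1)=0$, and $\hat\pi_{p_h\setminus p_h^k}=(n_{p_h}\hat\pi_{p_h}-n_{p_h^k}\hat\pi_{p_h^k})/(n_{p_h}-n_{p_h^k})$). Replacing $\hat T_n$ by a free variable $(u,v)$ in them turns $G_h^k$ into a function $\mathcal G_h^k(u,v)$, defined on the set $\tilde D_n$ of all $(u,v)$ for which all these linear functions take values in $(0,1)$. Put $\lambda_h=e^{\epsilon_h\mathcal G_h^1}/\sum_ke^{\epsilon_h\mathcal G_h^k}$ on $\tilde D_n$ and $\lambda_h=0$ outside. With $\Pi_{n,1}=\sqrt{n_1}\,\pi_{1,n}$, $\sigma_{n,1}^2=\pi_{1,n}(1-\pi_{1,n})$, and $\phi(\cdot;\mu,\sigma^2)$ the normal density, let $$\mathrm{Pivot}(\hat T_{n,1};\Pi_{n,1})=\frac{\int_{-\infty}^{\hat T_{n,1}}\phi(u;\Pi_{n,1},\sigma_{n,1}^2)\prod_{h=1}^d\lambda_h(u,\hat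 T_{n,-1})\,du}{\int_{-\infty}^{\infty}\phi(u;\Pi_{n,1},\sigma_{n,1}^2)\prod_{h=1}^d\lambda_h(u,\hat T_{n,-1})\,du}$$ if $\hat T_n\in\tilde D_n$, and $0$ otherwise. **Theorem.** Assume: 1. $\limsup_{n\to\infty}n/n_R<\infty$ for $R\in\{l_1,\ p_h^k,\ p_h\setminus p_h^k:\ h\le d,\ k\le k_h\}$; 2. $\liminf_n\pi_{j,n}>0$ and $\limsup_n\pi_{j,n}<1$ for all $j\le m$; 3. there are constants $b,B>0$ such that, for all sufficiently large $n$, $\Sigma_n$ is positive definite and all its eigenvalues lie in $(1/b^2,B^2)$; 4. $\mathcal I$ is bounded and three times differentiable on $(0,1)$, with bounded first, second and third derivatives there ($\mathcal I$ may take any real values at $0$ and $1$). Then the event $\{S_h=s_h^1\text{ for all }h\le d\}$ has positive probability for every $n$, and conditionally on it $\mathrm{Pivot}(\hat T_{n,1};\Pi_{n,1})$ converges in distribution to the uniform distribution on $[0,1]$ as $n\to\infty$. -/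

import Mathlib

open MeasureTheory ProbabilityTheory Filter Topology
open scoped ENNReal

noncomputable section

namespace ExpTree

/-! ## Samples, information gain and the exponential mechanism -/

/-- The number `n_R` of the sample points `X i` that lie in the region `R`. -/
def count {𝒳 : Type*} {n : ℕ} (X : Fin n → 𝒳) (R : Set 𝒳) : ℕ :=
  {i : Fin n | X i ∈ R}.ncard

/-- The proportion of ones, `(1 / n_R) ∑ i, Y_i 1[X_i ∈ R]`, among the binary outcomes observed in
the region `R` (`true` is the outcome `1`, `false` is the outcome `0`). -/
def prop {𝒳 : Type*} {n : ℕ} (X : Fin n → 𝒳) (y : Fin n → Bool) (R : Set 𝒳) : ℝ :=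
  (1 / (count X R : ℝ)) * ∑ i, (if y i then (1 : ℝ) else 0) * R.indicator 1 (X i)

/-- The information gain of the binary split of the region `P` into `Q` and `P \ Q`, for the
impurity function `I`. -/
def gain {𝒳 : Type*} {n : ℕ} (I : ℝ → ℝ) (X : Fin n → 𝒳) (y : Fin n → Bool) (P Q : Set 𝒳) : ℝ :=
  I (prop X y P) -
    ((count X Q : ℝ) / (count X P : ℝ) * I (prop X y Q) +
      (count X (P \ Q) : ℝ) / (count X P : ℝ) * I (prop X y (P \ Q)))

/-- The exponential mechanism with temperature parameter `ε` at the region `P`: the probability of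
drawing, given the outcomes `y`, the split of `P` into `Q s` and `P \ Q s`, the candidate splits
being indexed by `Fin k`. -/
def splitProb {𝒳 : Type*} {n k : ℕ} (I : ℝ → ℝ) (ε : ℝ) (X : Fin n → 𝒳) (y : Fin n → Bool)
    (P : Set 𝒳) (Q : Fin k → Set 𝒳) (s : Fin k) : ℝ :=
  Real.exp (ε * gain I X y P (Q s)) / ∑ s', Real.exp (ε * gain I X y P (Q s'))

/-! ## The observed tree -/

/-- An observed tree fit on the predictor space `𝒳`, as far as it concerns the first leaf:
a partition of `𝒳` into `m` leaves, the path of regions from the root `𝒳` to the first leaf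
(leaf `0`), and for each of the `d` internal regions of the path its `k h` candidate splits, of
which the one with index `0` is the split that was observed. A split is given by one of the two
regions that it creates; for the observed split this is the next region on the path. -/
structure TreeFit (𝒳 : Type*) (d m : ℕ) (k : Fin d → ℕ) [NeZero m] [∀ h, NeZero (k h)] where
  /-- the internal regions of the path, from the root on, followed by the first leaf -/
  node : Fin (d + 1) → Set 𝒳
  /-- the candidate regions obtained by splitting the internal regions of the path -/
  child : ∀ h : Fin d, Fin (k h) → Set 𝒳
  /-- the leaves -/
  leaf : Fin m → Set 𝒳
  node_zero : node 0 = Set.univ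
  node_last : node (Fin.last d) = leaf 0
  child_subset : ∀ h j, child h j ⊆ node h.castSucc
  child_zero : ∀ h, child h 0 = node h.succ
  leaf_disjoint : Pairwise (Function.onFun Disjoint leaf)
  leaf_cover : ⋃ j, leaf j = Set.univ

/-- The success probability `θ = ∑ j, π_j 1[x ∈ l_j]` of an outcome at the predictor value `x`. -/
def TreeFit.theta {𝒳 : Type*} {d m : ℕ} {k : Fin d → ℕ} [NeZero m] [∀ h, NeZero (k h)]
    (t : TreeFit 𝒳 d m k) (π : Fin m → ℝ) (x : 𝒳) : ℝ :=
  ∑ j, π j * (t.leaf j).indicator 1 x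

/-! ## Key statistics -/

/-- The index set of the nuisance statistics: `⟨h, 0⟩` stands for the internal region `p_h`, and
`⟨h, j⟩` with `j ≠ 0` for the candidate region number `j` of `p_h`. -/
abbrev NuisIdx {d : ℕ} (k : Fin d → ℕ) : Type := Σ h : Fin d, Fin (k h)

/-- The index set, of size `1 + ∑ h, k h`, of all key statistics; `none` is the index of the main
statistic. -/
abbrev StatIdx {d : ℕ} (k : Fin d → ℕ) : Type := Option (NuisIdx k)

section Tree

variable {𝒳 : Type*} {d m : ℕ} {k : Fin d → ℕ} [NeZero m] [∀ h, NeZero (k h)]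

/-- The region to which a nuisance statistic belongs. -/
def TreeFit.region (t : TreeFit 𝒳 d m k) (a : NuisIdx k) : Set 𝒳 :=
  if a.2 = 0 then t.node a.1.castSucc else t.child a.1 a.2

/-- The main statistic: `√n₁` times the sample proportion in the first leaf. -/
def mainStat {n : ℕ} (t : TreeFit 𝒳 d m k) (X : Fin n → 𝒳) (y : Fin n → Bool) : ℝ :=
  √(count X (t.leaf 0)) * prop X y (t.leaf 0)

/-- The orthogonalized proportion of a region `R`. -/
def orthStat {n : ℕ} (t : TreeFit 𝒳 d m k) (X : Fin n → 𝒳) (y : Fin n → Bool) (R : Set 𝒳) : ℝ :=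
  √(count X R) * prop X y R -
    (count X (R ∩ t.leaf 0) : ℝ) / √((count X (t.leaf 0) : ℝ) * (count X R : ℝ)) *
      (√(count X (t.leaf 0)) * prop X y (t.leaf 0))

/-- The vector of nuisance statistics. -/
def nuisStat {n : ℕ} (t : TreeFit 𝒳 d m k) (X : Fin n → 𝒳) (y : Fin n → Bool) : NuisIdx k → ℝ :=
  fun a => orthStat t X y (t.region a)

/-- The vector of key statistics. -/
def keyStat {n : ℕ} (t : TreeFit 𝒳 d m k) (X : Fin n → 𝒳) (y : Fin n → Bool) : StatIdx k → ℝ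
  | none => mainStat t X y
  | some a => nuisStat t X y a

/-- The covariance matrix of the key statistics when the outcomes are the random vector `Y`, the
tree being held fixed. -/
def covMatrix {n : ℕ} {Ω : Type*} [MeasurableSpace Ω] (t : TreeFit 𝒳 d m k) (X : Fin n → 𝒳)
    (Y : Fin n → Ω → Bool) (P : Measure Ω) : Matrix (StatIdx k) (StatIdx k) ℝ :=
  Matrix.of fun a b =>
    cov[fun ω => keyStat t X (fun i => Y i ω) a, fun ω => keyStat t X (fun i => Y i ω) b; P]

/-! ## Gains and selection probabilities as functions of the key statistics -/

/-- The scaling vector `η` of the split of `P` into `Q` and `P \ Q`, where `L` is the first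
leaf. -/
def eta {n : ℕ} (X : Fin n → 𝒳) (L P Q : Set 𝒳) : Fin 8 → ℝ :=
  ![√(count X L) / count X P,
    1 / √(count X P),
    (count X (Q ∩ L) : ℝ) / (count X Q * √(count X L)),
    1 / √(count X Q),
    ((count X (P ∩ L) : ℝ) - count X (Q ∩ L)) / (((count X P : ℝ) - count X Q) * √(count X L)),
    √(count X P) / ((count X P : ℝ) - count X Q),
    -(√(count X Q) / ((count X P : ℝ) - count X Q)),
    (count X Q : ℝ) / count X P]

/-- The domain of `gainMap I η`: the three proportions lie strictly between `0` and `1`. -/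
def gainDomain (η : Fin 8 → ℝ) : Set (ℝ × ℝ × ℝ) :=
  {p | η 0 * p.1 + η 1 * p.2.1 ∈ Set.Ioo (0 : ℝ) 1 ∧
    η 2 * p.1 + η 3 * p.2.2 ∈ Set.Ioo (0 : ℝ) 1 ∧
    η 4 * p.1 + η 5 * p.2.1 + η 6 * p.2.2 ∈ Set.Ioo (0 : ℝ) 1}

/-- The gain of a split with scaling vector `η` as a function of three key statistics. -/
def gainMap (I : ℝ → ℝ) (η : Fin 8 → ℝ) (p : ℝ × ℝ × ℝ) : ℝ :=
  I (η 0 * p.1 + η 1 * p.2.1) - η 7 * I (η 2 * p.1 + η 3 * p.2.2) -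
    (1 - η 7) * I (η 4 * p.1 + η 5 * p.2.1 + η 6 * p.2.2)

/-- The coordinate of `v` that belongs to a region of the path; for the region that ends the path,
which is the first leaf, the orthogonalized proportion vanishes. -/
def nodeCoord (v : NuisIdx k → ℝ) : Fin (d + 1) → ℝ :=
  Fin.lastCases 0 fun h => v ⟨h, 0⟩

/-- The three statistics on which the gain of the candidate split `j` of `p_h` depends. -/
def splitArgs (u : ℝ) (v : NuisIdx k → ℝ) (h : Fin d) (j : Fin (k h)) : ℝ × ℝ × ℝ :=
  (u, nodeCoord v h.castSucc, if j = 0 then nodeCoord v h.succ else v ⟨h, j⟩)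

/-- The scaling vector of the candidate split `j` of `p_h`. -/
def splitEta {n : ℕ} (t : TreeFit 𝒳 d m k) (X : Fin n → 𝒳) (h : Fin d) (j : Fin (k h)) :
    Fin 8 → ℝ :=
  eta X (t.leaf 0) (t.node h.castSucc) (t.child h j)

/-- The values of the key statistics at which all gains along the path are defined. -/
def statDomain {n : ℕ} (t : TreeFit 𝒳 d m k) (X : Fin n → 𝒳) : Set (ℝ × (NuisIdx k → ℝ)) :=
  {p | ∀ h j, splitArgs p.1 p.2 h j ∈ gainDomain (splitEta t X h j)}

open Classical in
/-- The probability of the observed split of `p_h` as a function of the key statistics, extended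
by `0` outside of its domain. -/
def lambda {n : ℕ} (I : ℝ → ℝ) (ε : Fin d → ℝ) (t : TreeFit 𝒳 d m k) (X : Fin n → 𝒳)
    (h : Fin d) (u : ℝ) (v : NuisIdx k → ℝ) : ℝ :=
  if (u, v) ∈ statDomain t X then
    Real.exp (ε h * gainMap I (splitEta t X h 0) (splitArgs u v h 0)) /
      ∑ j, Real.exp (ε h * gainMap I (splitEta t X h j) (splitArgs u v h j))
  else 0

/-! ## The pivot -/

/-- The integrand of the pivot: the normal density with mean `Π` and variance `σ²`, corrected by
the selection probabilities. -/
def pivotDensity {n : ℕ} (I : ℝ → ℝ) (ε : Fin d → ℝ) (t : TreeFit 𝒳 d m k) (X : Fin n → 𝒳)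
    (mean var : ℝ) (v : NuisIdx k → ℝ) (u : ℝ) : ℝ :=
  gaussianPDFReal mean var.toNNReal u * ∏ h, lambda I ε t X h u v

open Classical in
/-- The pivot as a function of the key statistics, extended by `0` outside of their domain. Its
mean is `√n₁ π₁` and its variance is `π₁ (1 - π₁)`, where `π₁` is the mean of the first leaf. -/
def pivotFun {n : ℕ} (I : ℝ → ℝ) (ε : Fin d → ℝ) (t : TreeFit 𝒳 d m k) (X : Fin n → 𝒳)
    (π₁ : ℝ) (u : ℝ) (v : NuisIdx k → ℝ) : ℝ :=
  if (u, v) ∈ statDomain t X then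
    (∫ u' in Set.Iic u,
        pivotDensity I ε t X (√(count X (t.leaf 0)) * π₁) (π₁ * (1 - π₁)) v u') /
      ∫ u', pivotDensity I ε t X (√(count X (t.leaf 0)) * π₁) (π₁ * (1 - π₁)) v u'
  else 0

/-- The pivot, evaluated at the observed outcomes `y`. -/
def pivot {n : ℕ} (I : ℝ → ℝ) (ε : Fin d → ℝ) (t : TreeFit 𝒳 d m k) (X : Fin n → 𝒳)
    (π₁ : ℝ) (y : Fin n → Bool) : ℝ :=
  pivotFun I ε t X π₁ (mainStat t X y) (nuisStat t X y)

end Tree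

/-! ## Assumption on the impurity function -/

/-- On the open interval `(0, 1)`, the function `I` is bounded and three times differentiable,
with bounded first, second and third derivatives. -/
def BoundedThriceDiff (I : ℝ → ℝ) : Prop :=
  (∀ j < 3, DifferentiableOn ℝ (iteratedDeriv j I) (Set.Ioo 0 1)) ∧
    ∃ C : ℝ, ∀ j ≤ 3, ∀ x ∈ Set.Ioo (0 : ℝ) 1, |iteratedDeriv j I x| ≤ C

/-- The uniform distribution on `[0, 1]`. -/
def uniformLaw : Measure ℝ := volume.restrict (Set.Icc 0 1)

instance : IsProbabilityMeasure uniformLaw :=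
  ⟨by simp [uniformLaw]⟩

end ExpTree

end

/-! Given the outcomes, the observed splits are selected with a probability that is a continuous
function of the proportions in the candidate regions. By the weak law of large numbers these
proportions are close to their means, so this probability is close to a number that is not random
and stays away from `0`. Conditioning on the selection therefore reweights the law of the outcomes
by an asymptotically constant factor and does not change limits in distribution.

The same continuity applies to the weight `∏ λ_h(u, ·)` in the pivot as long as `u` lies in a
window around the mean `√n₁ π₁` whose width is a small multiple of `√n₁`. The Gaussian mass outside
the window is negligible, so the pivot is asymptotically the value at the key statistic of the
Gaussian distribution function with mean `√n₁ π₁` and variance `π₁ (1 - π₁)`, which is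
asymptotically uniform by the central limit theorem for the proportion in the leaf. -/

noncomputable section

namespace ExpTree

open scoped BigOperators

section CentralLimitTheorem

lemma norm_prod_sub_prod_le {ι R : Type*} [NormedCommRing R] [NormOneClass R]
    {f g : ι → R} {s : Finset ι} (hf : ∀ i ∈ s, ‖f i‖ ≤ 1) (hg : ∀ i ∈ s, ‖g i‖ ≤ 1) :
    ‖∏ i ∈ s, f i - ∏ i ∈ s, g i‖ ≤ ∑ i ∈ s, ‖f i - g i‖ := by
  induction s using Finset.cons_induction with
  | empty => simp
  | cons a s ha ih =>
    simp only [Finset.mem_cons, forall_eq_or_imp] at hf hg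
    have hprod : ‖∏ i ∈ s, f i‖ ≤ 1 :=
      (s.norm_prod_le f).trans (Finset.prod_le_one (fun _ _ => norm_nonneg _) hf.2)
    rw [Finset.prod_cons, Finset.prod_cons, Finset.sum_cons]
    calc ‖f a * ∏ i ∈ s, f i - g a * ∏ i ∈ s, g i‖
        = ‖(f a - g a) * ∏ i ∈ s, f i + g a * (∏ i ∈ s, f i - ∏ i ∈ s, g i)‖ := by ring_nf
      _ ≤ ‖f a - g a‖ * ‖∏ i ∈ s, f i‖ + ‖g a‖ * ‖∏ i ∈ s, f i - ∏ i ∈ s, g i‖ :=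
          (norm_add_le _ _).trans (add_le_add (norm_mul_le _ _) (norm_mul_le _ _))
      _ ≤ ‖f a - g a‖ * 1 + 1 * ∑ i ∈ s, ‖f i - g i‖ := by
          gcongr
          exacts [hg.1, ih hf.2 hg.2]
      _ = ‖f a - g a‖ + ∑ i ∈ s, ‖f i - g i‖ := by ring

lemma norm_exp_neg_sub_one_sub_le (x : ℝ) :
    ‖Complex.exp ((-x : ℝ) : ℂ) - (1 - x : ℝ)‖ ≤ |x| ^ 2 * Real.exp |x| := by
  have h := Complex.norm_exp_sub_sum_le_norm_mul_exp ((-x : ℝ) : ℂ) 2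
  simpa [Finset.sum_range_succ, sub_eq_add_neg] using h

lemma norm_exp_mul_I_sub_quadratic_le (x : ℝ) :
    ‖Complex.exp (x * Complex.I) - (1 + x * Complex.I - (x ^ 2 / 2 : ℝ))‖ ≤
      |x| ^ 3 * Real.exp |x| := by
  have h := Complex.norm_exp_sub_sum_le_norm_mul_exp (x * Complex.I) 3
  simpa [Finset.sum_range_succ, mul_pow, neg_div, sub_eq_add_neg, add_assoc] using h

variable {Ω : Type*} [MeasurableSpace Ω] {P : Measure Ω} [IsProbabilityMeasure P] {Z : Ω → ℝ}
  {b : ℝ}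

lemma norm_charFun_map_sub_le (hZ : AEMeasurable Z P) (hbound : ∀ᵐ ω ∂P, |Z ω| ≤ b)
    (hmean : P[Z] = 0) (t : ℝ) :
    ‖charFun (P.map Z) t - (1 - t ^ 2 * Var[Z; P] / 2 : ℝ)‖ ≤
      |t| ^ 3 * b * Real.exp (|t| * b) * Var[Z; P] := by
  have hZp : MemLp Z 2 P := MemLp.of_bound hZ.aestronglyMeasurable b hbound
  have hZ1 : Integrable Z P := hZp.integrable one_le_two
  have hZ2 : Integrable (fun ω => Z ω ^ 2) P := hZp.integrable_sq
  have hexp : Integrable (fun ω => Complex.exp ((t * Z ω : ℝ) * Complex.I)) P :=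
    .of_bound (by fun_prop) 1 (.of_forall fun ω => (Complex.norm_exp_ofReal_mul_I _).le)
  have hlin : Integrable (fun ω => ((t * Z ω : ℝ) : ℂ) * Complex.I) P :=
    (hZ1.const_mul t).ofReal.mul_const _
  have hquad : Integrable (fun ω => (((t * Z ω) ^ 2 / 2 : ℝ) : ℂ)) P := by
    simp only [mul_pow]
    exact ((hZ2.const_mul _).div_const 2).ofReal
  have hconst : Integrable (fun ω => 1 + ((t * Z ω : ℝ) : ℂ) * Complex.I) P :=
    (integrable_const _).add hlin
  have htaylor : Integrable
      (fun ω => 1 + ((t * Z ω : ℝ) : ℂ) * Complex.I - ((t * Z ω) ^ 2 / 2 : ℝ)) P :=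
    hconst.sub hquad
  have hremainder : charFun (P.map Z) t - (1 - t ^ 2 * Var[Z; P] / 2 : ℝ) =
      ∫ ω, (Complex.exp ((t * Z ω : ℝ) * Complex.I) -
        (1 + ((t * Z ω : ℝ) : ℂ) * Complex.I - ((t * Z ω) ^ 2 / 2 : ℝ))) ∂P := by
    rw [integral_sub hexp htaylor, integral_sub hconst hquad,
      integral_add (integrable_const _) hlin, integral_mul_const, integral_complex_ofReal,
      integral_complex_ofReal, integral_const_mul, hmean, charFun_apply_real,
      integral_map hZ (by fun_prop)]
    simp only [mul_pow, integral_div, integral_const_mul, variance_of_integral_eq_zero hZ hmean]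
    simp
  have hpointwise : ∀ᵐ ω ∂P, ‖Complex.exp ((t * Z ω : ℝ) * Complex.I) -
      (1 + ((t * Z ω : ℝ) : ℂ) * Complex.I - ((t * Z ω) ^ 2 / 2 : ℝ))‖ ≤
        |t| ^ 3 * b * Real.exp (|t| * b) * Z ω ^ 2 := by
    filter_upwards [hbound] with ω hω
    have hb : 0 ≤ b := (abs_nonneg _).trans hω
    calc _ ≤ |t * Z ω| ^ 3 * Real.exp |t * Z ω| := norm_exp_mul_I_sub_quadratic_le _
      _ = |t| ^ 3 * |Z ω| * Real.exp (|t| * |Z ω|) * Z ω ^ 2 := by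
        rw [abs_mul, ← sq_abs (Z ω)]; ring
      _ ≤ |t| ^ 3 * b * Real.exp (|t| * b) * Z ω ^ 2 := by gcongr
  rw [hremainder, variance_of_integral_eq_zero hZ hmean, ← integral_const_mul]
  exact norm_integral_le_of_norm_le (hZ2.const_mul _) hpointwise

lemma variance_le_sq_of_abs_le (hZ : AEMeasurable Z P) (hbound : ∀ᵐ ω ∂P, |Z ω| ≤ b) :
    Var[Z; P] ≤ b ^ 2 := by
  have h : ∀ᵐ ω ∂P, Z ω ∈ Set.Icc (-b) b := hbound.mono fun ω hω => abs_le.1 hω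
  calc Var[Z; P] ≤ ((b - -b) / 2) ^ 2 := variance_le_sq_of_bounded h hZ
    _ = b ^ 2 := by ring

/-- Bounds `|φ - exp (-t² σ² / 2)|`, relative to `σ²`, for the characteristic function `φ` of a
centred variable with variance `σ²` and absolute value at most `b`. -/
def charFunError (t b : ℝ) : ℝ :=
  |t| ^ 3 * b * Real.exp (|t| * b) + (t ^ 2 / 2) ^ 2 * b ^ 2 * Real.exp (t ^ 2 / 2 * b ^ 2)

lemma tendsto_charFunError_zero (t : ℝ) : Tendsto (charFunError t) (𝓝 0) (𝓝 0) := by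
  have h : Continuous (charFunError t) := by unfold charFunError; fun_prop
  simpa [charFunError] using h.tendsto 0

lemma norm_charFun_map_sub_exp_le (hZ : AEMeasurable Z P) (hbound : ∀ᵐ ω ∂P, |Z ω| ≤ b)
    (hmean : P[Z] = 0) (t : ℝ) :
    ‖charFun (P.map Z) t - Complex.exp ((-(t ^ 2 / 2 * Var[Z; P]) : ℝ) : ℂ)‖ ≤
      charFunError t b * Var[Z; P] := by
  have hv0 : 0 ≤ Var[Z; P] := variance_nonneg _ _
  have hx : |t ^ 2 / 2 * Var[Z; P]| = t ^ 2 / 2 * Var[Z; P] := abs_of_nonneg (by positivity)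
  have hexp := norm_exp_neg_sub_one_sub_le (t ^ 2 / 2 * Var[Z; P])
  have hchar := norm_charFun_map_sub_le hZ hbound hmean t
  rw [hx] at hexp
  rw [mul_div_right_comm] at hchar
  have hvb : Var[Z; P] ≤ b ^ 2 := variance_le_sq_of_abs_le hZ hbound
  calc _ ≤ |t| ^ 3 * b * Real.exp (|t| * b) * Var[Z; P] +
        (t ^ 2 / 2 * Var[Z; P]) ^ 2 * Real.exp (t ^ 2 / 2 * Var[Z; P]) := by
        refine (norm_sub_le_norm_sub_add_norm_sub _ _ _).trans (add_le_add hchar ?_)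
        rwa [norm_sub_rev]
    _ = |t| ^ 3 * b * Real.exp (|t| * b) * Var[Z; P] +
        (t ^ 2 / 2) ^ 2 * Var[Z; P] * Real.exp (t ^ 2 / 2 * Var[Z; P]) * Var[Z; P] := by ring
    _ ≤ |t| ^ 3 * b * Real.exp (|t| * b) * Var[Z; P] +
        (t ^ 2 / 2) ^ 2 * b ^ 2 * Real.exp (t ^ 2 / 2 * b ^ 2) * Var[Z; P] := by gcongr
    _ = charFunError t b * Var[Z; P] := by rw [charFunError]; ring

end CentralLimitTheorem

section CentralLimitTheorem

variable {Ω : ℕ → Type*} [∀ n, MeasurableSpace (Ω n)] {P : (n : ℕ) → Measure (Ω n)}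
  [∀ n, IsProbabilityMeasure (P n)] {ι : ℕ → Type*} {J : (n : ℕ) → Finset (ι n)}

theorem tendstoInDistribution_sum_of_abs_le {Z : (n : ℕ) → ι n → Ω n → ℝ} {b : ℕ → ℝ}
    (hZ : ∀ n i, AEMeasurable (Z n i) (P n)) (hind : ∀ n, iIndepFun (Z n) (P n))
    (hmean : ∀ n, ∀ i ∈ J n, (P n)[Z n i] = 0)
    (hbound : ∀ n, ∀ i ∈ J n, ∀ᵐ ω ∂P n, |Z n i ω| ≤ b n) (hb : Tendsto b atTop (𝓝 0))
    (hvar : ∀ᶠ n in atTop, ∑ i ∈ J n, Var[Z n i; P n] = 1) :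
    TendstoInDistribution (fun n ω => ∑ i ∈ J n, Z n i ω) atTop (fun x : ℝ => x) P
      (gaussianReal 0 1) := by
  refine ⟨fun n => Finset.aemeasurable_fun_sum _ fun i _ => hZ n i, aemeasurable_id', ?_⟩
  refine ProbabilityMeasure.tendsto_iff_tendsto_charFun.2 fun t => ?_
  simp only [ProbabilityMeasure.coe_mk, Measure.map_id', charFun_gaussianReal]
  rw [tendsto_iff_norm_sub_tendsto_zero]
  refine squeeze_zero' (.of_forall fun n => norm_nonneg _) ?_
    ((tendsto_charFunError_zero t).comp hb)
  filter_upwards [hvar] with n hn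
  have hlimit : Complex.exp (t * (0 : ℝ) * Complex.I - (1 : NNReal) * t ^ 2 / 2) =
      ∏ i ∈ J n, Complex.exp ((-(t ^ 2 / 2 * Var[Z n i; P n]) : ℝ) : ℂ) := by
    rw [← Complex.exp_sum, ← Complex.ofReal_sum, Finset.sum_neg_distrib, ← Finset.mul_sum, hn]
    simp
  have hnorm : ∀ i ∈ J n, ‖Complex.exp ((-(t ^ 2 / 2 * Var[Z n i; P n]) : ℝ) : ℂ)‖ ≤ 1 := by
    intro i _
    have := variance_nonneg (Z n i) (P n)
    rw [Complex.norm_exp_ofReal, Real.exp_le_one_iff, neg_nonpos]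
    positivity
  rw [iIndepFun.charFun_map_fun_finsetSum_eq_prod (fun i _ => hZ n i) ((hind n).restrict _),
    Finset.prod_apply, hlimit]
  have (i : ι n) : IsProbabilityMeasure ((P n).map (Z n i)) :=
    Measure.isProbabilityMeasure_map (hZ n i)
  calc _ ≤ ∑ i ∈ J n, ‖charFun ((P n).map (Z n i)) t -
          Complex.exp ((-(t ^ 2 / 2 * Var[Z n i; P n]) : ℝ) : ℂ)‖ :=
        norm_prod_sub_prod_le (fun i _ => norm_charFun_le_one t) hnorm
    _ ≤ ∑ i ∈ J n, charFunError t (b n) * Var[Z n i; P n] := Finset.sum_le_sum fun i hi =>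
        norm_charFun_map_sub_exp_le (hZ n i) (hbound n i hi) (hmean n i hi) t
    _ = charFunError t (b n) := by rw [← Finset.mul_sum, hn, mul_one]

end CentralLimitTheorem

section ProbabilityIntegralTransform

variable (μ : Measure ℝ) [IsProbabilityMeasure μ] [NullSingletonClass μ]

lemma continuous_cdf : Continuous (cdf μ) := by
  refine continuous_iff_continuousAt.2 fun x => continuousAt_iff_continuous_left'_right'.2 ⟨?_, ?_⟩
  · have hjump : (cdf μ).measure {x} = 0 := by rw [measure_cdf, measure_singleton]
    rw [StieltjesFunction.measure_singleton, ENNReal.ofReal_eq_zero, sub_nonpos] at hjump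
    rw [(monotone_cdf μ).continuousWithinAt_Iio_iff_leftLim_eq]
    exact ((monotone_cdf μ).leftLim_le le_rfl).antisymm hjump
  · exact ((cdf μ).right_continuous x).mono Set.Ioi_subset_Ici_self

lemma exists_cdf_eq {s : ℝ} (hs : s ∈ Set.Ioo 0 1) : ∃ x, cdf μ x = s :=
  mem_range_of_exists_le_of_exists_ge (continuous_cdf μ)
    ((tendsto_cdf_atBot μ).eventually_le_const hs.1).exists
    ((tendsto_cdf_atTop μ).eventually_const_le hs.2).exists

lemma measureReal_cdf_le {s : ℝ} (hs : s ∈ Set.Ico 0 1) : μ.real {x | cdf μ x ≤ s} = s := by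
  refine le_antisymm (le_of_forall_gt_imp_ge_of_dense fun r hr => ?_) ?_
  · rcases lt_or_ge r 1 with hr1 | hr1
    · obtain ⟨x, rfl⟩ := exists_cdf_eq μ ⟨hs.1.trans_lt hr, hr1⟩
      rw [cdf_eq_real μ x]
      refine measureReal_mono fun y hy => ?_
      exact ((monotone_cdf μ).reflect_lt (hy.trans_lt hr)).le
    · exact measureReal_le_one.trans hr1
  · rcases hs.1.eq_or_lt with rfl | hs0
    · exact measureReal_nonneg
    · obtain ⟨x, rfl⟩ := exists_cdf_eq μ ⟨hs0, hs.2⟩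
      rw [cdf_eq_real μ x]
      exact measureReal_mono fun y hy => by simpa [← cdf_eq_real] using monotone_cdf μ hy

lemma uniformLaw_real_Iic (s : ℝ) : uniformLaw.real (Set.Iic s) = max 0 (min s 1) := by
  have h : Set.Iic s ∩ Set.Icc 0 1 = Set.Icc 0 (min s 1) := by
    ext x
    simp only [Set.mem_inter_iff, Set.mem_Iic, Set.mem_Icc, le_min_iff]
    tauto
  rw [uniformLaw, measureReal_restrict_apply measurableSet_Iic, h, Real.volume_real_Icc, sub_zero,
    max_comm]

theorem map_cdf_eq_uniformLaw : μ.map (cdf μ) = uniformLaw := by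
  have hcdf : Measurable (cdf μ) := (monotone_cdf μ).measurable
  have : IsProbabilityMeasure (μ.map (cdf μ)) := Measure.isProbabilityMeasure_map hcdf.aemeasurable
  refine Measure.ext_of_Iic _ _ fun s => (measureReal_eq_measureReal_iff).1 ?_
  rw [map_measureReal_apply hcdf measurableSet_Iic, uniformLaw_real_Iic]
  rcases lt_or_ge s 0 with hs0 | hs0
  · have hempty : cdf μ ⁻¹' Set.Iic s = ∅ :=
      Set.eq_empty_of_forall_notMem fun x hx => (hx.trans_lt hs0).not_ge (cdf_nonneg μ x)
    rw [hempty, measureReal_empty, max_eq_left ((min_le_left _ _).trans hs0.le)]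
  rcases lt_or_ge s 1 with hs1 | hs1
  · rw [min_eq_left hs1.le, max_eq_right hs0]
    exact measureReal_cdf_le μ ⟨hs0, hs1⟩
  · have huniv : cdf μ ⁻¹' Set.Iic s = Set.univ :=
      Set.eq_univ_of_forall fun x => (cdf_le_one μ x).trans hs1
    rw [huniv, probReal_univ, min_eq_right hs1, max_eq_right zero_le_one]

lemma tendstoInDistribution_cdf {ι : Type*} {l : Filter ι} {Ω : ι → Type*}
    [∀ i, MeasurableSpace (Ω i)] {P : (i : ι) → Measure (Ω i)} [∀ i, IsProbabilityMeasure (P i)]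
    {Z : (i : ι) → Ω i → ℝ} (h : TendstoInDistribution Z l (fun x : ℝ => x) P μ) :
    TendstoInDistribution (fun i ω => cdf μ (Z i ω)) l (fun x : ℝ => x) P uniformLaw := by
  have hcomp := h.continuous_comp (continuous_cdf μ)
  have hlaw : μ.map (cdf μ ∘ fun x => x) = uniformLaw.map fun x => x := by
    rw [Measure.map_id']
    exact map_cdf_eq_uniformLaw μ
  refine ⟨hcomp.forall_aemeasurable, aemeasurable_id', ?_⟩
  have hlim := hcomp.tendsto
  simp_rw [hlaw] at hlim
  exact hlim

end ProbabilityIntegralTransform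

lemma cdf_gaussianReal (m : ℝ) {v : NNReal} (hv : v ≠ 0) (x : ℝ) :
    cdf (gaussianReal m v) x = cdf (gaussianReal 0 1) ((x - m) / √v) := by
  have hstd : (gaussianReal m v).map (fun y => (y - m) / √v) = gaussianReal 0 1 := by
    rw [← Function.comp_def (· / √(v : ℝ)) (· - m), ← Measure.map_map (by fun_prop) (by fun_prop),
      gaussianReal_map_sub_const, gaussianReal_map_div_const, sub_self, zero_div]
    congr 1
    ext
    simp [hv]
  have hpre : (fun y => (y - m) / √(v : ℝ)) ⁻¹' Set.Iic ((x - m) / √v) = Set.Iic x := by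
    have : 0 < √(v : ℝ) := Real.sqrt_pos.2 (NNReal.coe_pos.2 hv.bot_lt)
    ext y
    rw [Set.mem_preimage, Set.mem_Iic, Set.mem_Iic, div_le_div_iff_of_pos_right this,
      sub_le_sub_iff_right]
  rw [cdf_eq_real, cdf_eq_real, ← hstd, map_measureReal_apply (by fun_prop) measurableSet_Iic, hpre]

section Reweighting

lemma abs_div_sub_le_of_abs_sub_mul_le {N D F K e w : ℝ} (hK : 0 ≤ K) (hD : 0 ≤ D)
    (hND : |N| ≤ K * D) (hw : 0 < w) (hnum : |N - F * w| ≤ K * e) (hden : |D - w| ≤ e) :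
    |N / D - F| ≤ 2 * K * e / w := by
  have hsplit : (N / D - F) * w = N / D * (w - D) + (N - F * w) := by
    rcases hD.eq_or_lt' with rfl | h0
    · rw [abs_nonpos_iff.1 (hND.trans (by rw [mul_zero]))]
      ring
    · field
  rw [le_div_iff₀ hw]
  calc |N / D - F| * w = |N / D * (w - D) + (N - F * w)| := by
        rw [← hsplit, abs_mul, abs_of_pos hw]
    _ ≤ |N| / D * |D - w| + |N - F * w| := by
        refine (abs_add_le _ _).trans_eq ?_
        rw [abs_mul, abs_div, abs_of_nonneg hD, abs_sub_comm w]
    _ ≤ K * e + K * e := by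
        gcongr
        exact div_le_of_le_mul₀ hD hK hND
    _ = 2 * K * e := by ring

variable {α : Type*} [MeasurableSpace α] {μ : Measure α} [IsProbabilityMeasure μ]

lemma abs_integral_mul_div_integral_sub_le {f ψ : α → ℝ} {K w : ℝ}
    (hf : AEStronglyMeasurable f μ) (hfK : ∀ x, |f x| ≤ K) (hψ : Integrable ψ μ)
    (hψ0 : ∀ x, 0 ≤ ψ x) (hw : 0 < w) :
    |(∫ x, f x * ψ x ∂μ) / (∫ x, ψ x ∂μ) - ∫ x, f x ∂μ| ≤
      2 * K * (∫ x, |ψ x - w| ∂μ) / w := by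
  obtain ⟨x⟩ := nonempty_of_isProbabilityMeasure μ
  have hK : ∀ᵐ x ∂μ, ‖f x‖ ≤ K := .of_forall hfK
  have hfi : Integrable f μ := .of_bound hf K hK
  have hfψ : Integrable (fun x => f x * ψ x) μ := hψ.bdd_mul hf hK
  have hdev : Integrable (fun x => |ψ x - w|) μ := (hψ.sub (integrable_const w)).abs
  refine abs_div_sub_le_of_abs_sub_mul_le ((abs_nonneg _).trans (hfK x)) (integral_nonneg hψ0)
    ?_ hw ?_ ?_
  · rw [← integral_const_mul, ← Real.norm_eq_abs]
    refine norm_integral_le_of_norm_le (hψ.const_mul K) (.of_forall fun x => ?_)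
    rw [norm_mul, Real.norm_of_nonneg (hψ0 x)]
    exact mul_le_mul_of_nonneg_right (hfK x) (hψ0 x)
  · rw [← integral_mul_const, ← integral_sub hfψ (hfi.mul_const w), ← integral_const_mul,
      ← Real.norm_eq_abs]
    refine norm_integral_le_of_norm_le (hdev.const_mul K) (.of_forall fun x => ?_)
    rw [← mul_sub, norm_mul]
    exact mul_le_mul_of_nonneg_right (hfK x) (norm_nonneg _)
  · calc |(∫ x, ψ x ∂μ) - w| = |∫ x, (ψ x - w) ∂μ| := by
          rw [integral_sub hψ (integrable_const w)]
          simp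
      _ ≤ ∫ x, |ψ x - w| ∂μ := abs_integral_le_integral_abs

lemma integral_abs_le_add_measureReal {Z : α → ℝ} (hZ : AEMeasurable Z μ) {B κ : ℝ}
    (hB : ∀ x, |Z x| ≤ B) (hκ : 0 ≤ κ) :
    ∫ x, |Z x| ∂μ ≤ κ + B * μ.real {x | κ < |Z x|} := by
  have hS : NullMeasurableSet {x | κ < |Z x|} μ := nullMeasurableSet_lt aemeasurable_const hZ.abs
  have hind : Integrable ({x | κ < |Z x|}.indicator fun _ => B) μ :=
    (integrable_const B).indicator₀ hS
  have hle : ∀ x, |Z x| ≤ κ + {x | κ < |Z x|}.indicator (fun _ => B) x := by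
    intro x
    by_cases hx : x ∈ {x | κ < |Z x|}
    · rw [Set.indicator_of_mem hx]
      linarith [hB x]
    · rw [Set.indicator_of_notMem hx, add_zero]
      exact not_lt.1 hx
  calc ∫ x, |Z x| ∂μ ≤ ∫ x, (κ + {x | κ < |Z x|}.indicator (fun _ => B) x) ∂μ :=
        integral_mono_of_nonneg (.of_forall fun x => abs_nonneg _)
          ((integrable_const κ).add hind) (.of_forall hle)
    _ = κ + B * μ.real {x | κ < |Z x|} := by
        rw [integral_add (integrable_const κ) hind, integral_indicator₀ hS, setIntegral_const]
        simp [mul_comm]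

end Reweighting

section GaussianReweighting

variable {m : ℝ} {v : NNReal} {ψ : ℝ → ℝ} {w δ M : ℝ}

lemma gaussianReal_real_abs_sub_gt_le (hM : 0 < M) :
    (gaussianReal m v).real {u | M < |u - m|} ≤ v / M ^ 2 := by
  have h := meas_ge_le_variance_div_sq (μ := gaussianReal m v) (memLp_id_gaussianReal' 2 (by simp))
    hM
  simp only [id_eq, integral_id_gaussianReal, variance_id_gaussianReal] at h
  refine (measureReal_mono fun u (hu : M < |u - m|) => hu.le).trans ?_
  exact ENNReal.toReal_le_of_le_ofReal (by positivity) h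

lemma integral_abs_sub_gaussianReal_le (hψ : Measurable ψ) (hψ01 : ∀ u, ψ u ∈ Set.Icc 0 1)
    (hw : w ∈ Set.Icc 0 1) (hδ : 0 ≤ δ) (hM : 0 < M) (hnear : ∀ u, |u - m| ≤ M → |ψ u - w| ≤ δ) :
    ∫ u, |ψ u - w| ∂gaussianReal m v ≤ δ + v / M ^ 2 := by
  have hfar : {u | δ < |ψ u - w|} ⊆ {u | M < |u - m|} := fun u hu =>
    not_le.1 fun h => (hnear u h).not_gt hu
  calc ∫ u, |ψ u - w| ∂gaussianReal m v
      ≤ δ + 1 * (gaussianReal m v).real {u | δ < |ψ u - w|} :=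
        integral_abs_le_add_measureReal (by fun_prop)
          (fun u => Real.dist_le_of_mem_Icc_01 (hψ01 u) hw) hδ
    _ ≤ δ + v / M ^ 2 := by
        rw [one_mul]
        gcongr
        exact (measureReal_mono hfar).trans (gaussianReal_real_abs_sub_gt_le hM)

lemma integral_gaussianPDFReal_mul_eq (hv : v ≠ 0) (ψ : ℝ → ℝ) :
    ∫ u, gaussianPDFReal m v u * ψ u = ∫ u, ψ u ∂gaussianReal m v :=
  (integral_gaussianReal_eq_integral_smul hv).symm

lemma setIntegral_gaussianPDFReal_mul_eq (hv : v ≠ 0) (ψ : ℝ → ℝ) {s : Set ℝ}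
    (hs : MeasurableSet s) :
    ∫ u in s, gaussianPDFReal m v u * ψ u = ∫ u, s.indicator 1 u * ψ u ∂gaussianReal m v := by
  rw [← integral_gaussianPDFReal_mul_eq hv, ← integral_indicator hs]
  congr 1 with u
  by_cases hu : u ∈ s <;> simp [hu]

theorem abs_reweighted_cdf_gaussianReal_sub_le (hv : v ≠ 0) (hψ : Measurable ψ)
    (hψ01 : ∀ u, ψ u ∈ Set.Icc 0 1) (hw0 : 0 < w) (hw1 : w ≤ 1) (hδ : 0 ≤ δ) (hM : 0 < M)
    (hnear : ∀ u, |u - m| ≤ M → |ψ u - w| ≤ δ) (x : ℝ) :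
    |(∫ u in Set.Iic x, gaussianPDFReal m v u * ψ u) / (∫ u, gaussianPDFReal m v u * ψ u) -
      cdf (gaussianReal m v) x| ≤ 2 * (δ + v / M ^ 2) / w := by
  have hψi : Integrable ψ (gaussianReal m v) :=
    .of_bound hψ.aestronglyMeasurable 1 (.of_forall fun u => by
      simpa [abs_of_nonneg (hψ01 u).1] using (hψ01 u).2)
  have hind (u : ℝ) : |(Set.Iic x).indicator (1 : ℝ → ℝ) u| ≤ 1 := by
    by_cases hu : u ∈ Set.Iic x <;> simp [hu]
  have hreweight := abs_integral_mul_div_integral_sub_le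
    ((measurable_one.indicator measurableSet_Iic).aestronglyMeasurable) hind hψi
    (fun u => (hψ01 u).1) hw0
  rw [integral_indicator_one measurableSet_Iic, mul_one] at hreweight
  rw [setIntegral_gaussianPDFReal_mul_eq hv ψ measurableSet_Iic,
    integral_gaussianPDFReal_mul_eq hv ψ, cdf_eq_real]
  refine hreweight.trans ?_
  gcongr
  exact integral_abs_sub_gaussianReal_le hψ hψ01 ⟨hw0.le, hw1⟩ hδ hM hnear

end GaussianReweighting

section ConvergenceInProbability

variable {ι : Type*} {l : Filter ι} {Ω : ι → Type*} [∀ i, MeasurableSpace (Ω i)]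
  {P : (i : ι) → Measure (Ω i)}

/-- Convergence in probability to `0` of real random variables `Z i` on probability spaces that may
vary with `i`, which `MeasureTheory.TendstoInMeasure` does not allow. -/
def TendstoZeroInProbability (P : (i : ι) → Measure (Ω i)) (Z : (i : ι) → Ω i → ℝ)
    (l : Filter ι) : Prop :=
  ∀ κ > 0, Tendsto (fun i => (P i).real {ω | κ < |Z i ω|}) l (𝓝 0)

namespace TendstoZeroInProbability

variable [∀ i, IsProbabilityMeasure (P i)] {Z Z' : (i : ι) → Ω i → ℝ}

lemma of_abs_le_mul (hZ : TendstoZeroInProbability P Z l) {L : ℝ} (hL : 0 ≤ L)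
    (h : ∀ i ω, |Z' i ω| ≤ L * |Z i ω|) : TendstoZeroInProbability P Z' l := by
  intro κ hκ
  refine squeeze_zero (fun i => measureReal_nonneg) (fun i => measureReal_mono fun ω hω => ?_)
    (hZ (κ / (L + 1)) (by positivity))
  rw [Set.mem_ofPred_eq, div_lt_iff₀ (by positivity), mul_comm]
  calc κ < |Z' i ω| := hω
    _ ≤ (L + 1) * |Z i ω| := (h i ω).trans (by gcongr; linarith)

lemma of_forall_abs_le_imp {ρ : Type*} [Finite ρ] {D : ρ → (i : ι) → Ω i → ℝ}
    (hD : ∀ r, TendstoZeroInProbability P (D r) l)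
    (h : ∀ κ > 0, ∃ δ > 0, ∀ᶠ i in l, ∀ ω, (∀ r, |D r i ω| ≤ δ) → |Z i ω| ≤ κ) :
    TendstoZeroInProbability P Z l := by
  have := Fintype.ofFinite ρ
  intro κ hκ
  obtain ⟨δ, hδ, hZ⟩ := h κ hκ
  have hsum : Tendsto (fun i => ∑ r, (P i).real {ω | δ < |D r i ω|}) l (𝓝 0) := by
    simpa using tendsto_finsetSum Finset.univ fun r _ => hD r δ hδ
  refine squeeze_zero' (.of_forall fun i => measureReal_nonneg) ?_ hsum
  filter_upwards [hZ] with i hi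
  calc (P i).real {ω | κ < |Z i ω|} ≤ (P i).real (⋃ r, {ω | δ < |D r i ω|}) :=
        measureReal_mono fun ω hω => by
          contrapose! hω
          simp only [Set.mem_iUnion, Set.mem_ofPred_eq, not_exists, not_lt] at hω ⊢
          exact hi ω hω
    _ ≤ ∑ r, (P i).real {ω | δ < |D r i ω|} := measureReal_iUnion_fintype_le _

lemma tendsto_integral_abs (hZ : TendstoZeroInProbability P Z l)
    (hm : ∀ i, AEMeasurable (Z i) (P i)) {B : ℝ} (hB : ∀ᶠ i in l, ∀ ω, |Z i ω| ≤ B) :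
    Tendsto (fun i => ∫ ω, |Z i ω| ∂P i) l (𝓝 0) := by
  refine (nhds_basis_zero_abs_lt ℝ).tendsto_right_iff.2 fun η hη => ?_
  have hlim : Tendsto (fun i => η / 2 + B * (P i).real {ω | η / 2 < |Z i ω|}) l
      (𝓝 (η / 2 + B * 0)) := ((hZ (η / 2) (half_pos hη)).const_mul B).const_add _
  filter_upwards [hB, hlim.eventually_lt_const (show η / 2 + B * 0 < η by linarith)] with i hi hi'
  rw [abs_of_nonneg (integral_nonneg fun ω => abs_nonneg _)]
  exact (integral_abs_le_add_measureReal (hm i) hi (half_pos hη).le).trans_lt hi'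

end TendstoZeroInProbability

variable [∀ i, IsProbabilityMeasure (P i)] {Ω' : Type*} [MeasurableSpace Ω'] {μ : Measure Ω'}
  [IsProbabilityMeasure μ]

theorem tendstoInDistribution_of_tendstoZeroInProbability_dist [l.IsCountablyGenerated]
    {E : Type*} [PseudoMetricSpace E] [MeasurableSpace E] [BorelSpace E] {Z : Ω' → E}
    {U V : (i : ι) → Ω i → E} (hU : TendstoInDistribution U l Z P μ)
    (hV : ∀ i, AEMeasurable (V i) (P i))
    (hUV : TendstoZeroInProbability P (fun i ω => dist (V i ω) (U i ω)) l) :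
    TendstoInDistribution V l Z P μ := by
  refine ⟨hV, hU.aemeasurable_limit, tendsto_iff_forall_lipschitz_integral_tendsto.2 ?_⟩
  rintro f ⟨C, hC⟩ ⟨L, hL⟩
  have hlim := tendsto_iff_forall_lipschitz_integral_tendsto.1 hU.tendsto f ⟨C, hC⟩ ⟨L, hL⟩
  have hUm := hU.forall_aemeasurable
  have hf : Measurable f := hL.continuous.measurable
  have hfU (i : ι) : AEMeasurable (fun ω => f (U i ω)) (P i) := hf.comp_aemeasurable (hUm i)
  have hfV (i : ι) : AEMeasurable (fun ω => f (V i ω)) (P i) := hf.comp_aemeasurable (hV i)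
  have hint {i : ι} {T : Ω i → E} (hT : AEMeasurable (fun ω => f (T ω)) (P i)) :
      Integrable (fun ω => f (T ω)) (P i) := by
    obtain ⟨ω₀⟩ := nonempty_of_isProbabilityMeasure (P i)
    refine .of_bound hT.aestronglyMeasurable (|f (T ω₀)| + C) (.of_forall fun ω => ?_)
    have := hC (T ω) (T ω₀)
    rw [Real.norm_eq_abs]
    linarith [abs_sub_abs_le_abs_sub (f (T ω)) (f (T ω₀)), Real.dist_eq (f (T ω)) (f (T ω₀))]
  have hdiff : Tendsto (fun i => ∫ ω, |f (V i ω) - f (U i ω)| ∂P i) l (𝓝 0) :=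
    (hUV.of_abs_le_mul L.2 fun i ω => by
      simpa [Real.dist_eq] using hL.dist_le_mul (V i ω) (U i ω)).tendsto_integral_abs
      (fun i => (hfV i).sub (hfU i)) (.of_forall fun i ω => hC _ _)
  simp only [ProbabilityMeasure.coe_mk, integral_map (hUm _) hf.aestronglyMeasurable] at hlim
  simp only [ProbabilityMeasure.coe_mk, integral_map (hV _) hf.aestronglyMeasurable]
  rw [← tendsto_sub_nhds_zero_iff] at hlim ⊢
  refine (zero_add (0 : ℝ) ▸ (squeeze_zero_norm (fun i => ?_) hdiff).add hlim).congr fun i =>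
    sub_add_sub_cancel _ (∫ ω, f (U i ω) ∂P i) _
  rw [← integral_sub (hint (hfV i)) (hint (hfU i))]
  exact abs_integral_le_integral_abs

theorem tendstoInDistribution_cond_of_tendstoZeroInProbability {E : Type*} [TopologicalSpace E]
    [MeasurableSpace E] [OpensMeasurableSpace E] {Z : Ω' → E} {V : (i : ι) → Ω i → E}
    (hV : TendstoInDistribution V l Z P μ) {A : (i : ι) → Set (Ω i)}
    [∀ i, IsProbabilityMeasure ((P i)[|A i])] {W : (i : ι) → Ω i → ℝ} {w : ι → ℝ} {c : ℝ}
    (hWm : ∀ i, AEMeasurable (W i) (P i)) (hW : ∀ i ω, W i ω ∈ Set.Icc 0 1) (hc : 0 < c)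
    (hw : ∀ᶠ i in l, w i ∈ Set.Icc c 1)
    (hWw : TendstoZeroInProbability P (fun i ω => W i ω - w i) l)
    (hA : ∀ i (f : E → ℝ), ∫ ω in A i, f (V i ω) ∂P i = ∫ ω, f (V i ω) * W i ω ∂P i) :
    TendstoInDistribution V l Z (fun i => (P i)[|A i]) μ := by
  have hVm := hV.forall_aemeasurable
  have hVm' (i : ι) : AEMeasurable (V i) ((P i)[|A i]) :=
    (hVm i).mono_ac (cond_absolutelyContinuous)
  refine ⟨hVm', hV.aemeasurable_limit, ProbabilityMeasure.tendsto_iff_forall_integral_tendsto.2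
    fun f => ?_⟩
  have hlim := ProbabilityMeasure.tendsto_iff_forall_integral_tendsto.1 hV.tendsto f
  have hf : Measurable f := f.continuous.measurable
  have hcond (i : ι) : ∫ ω, f (V i ω) ∂(P i)[|A i] =
      (∫ ω, f (V i ω) * W i ω ∂P i) / ∫ ω, W i ω ∂P i := by
    have hPA := hA i 1
    simp only [Pi.one_apply, one_mul, setIntegral_const, smul_eq_mul, mul_one] at hPA
    rw [ProbabilityTheory.cond, integral_smul_measure, hA, ← hPA, ENNReal.toReal_inv,
      measureReal_def, smul_eq_mul, inv_mul_eq_div]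
  have hdev : Tendsto (fun i => 2 * ‖f‖ * (∫ ω, |W i ω - w i| ∂P i) / c) l (𝓝 0) := by
    have h := hWw.tendsto_integral_abs (fun i => (hWm i).sub_const (w i))
      (hw.mono fun i hi ω => Real.dist_le_of_mem_Icc_01 (hW i ω) ⟨hc.le.trans hi.1, hi.2⟩)
    simpa using (h.const_mul (2 * ‖f‖)).div_const c
  simp only [ProbabilityMeasure.coe_mk, integral_map (hVm _) hf.aestronglyMeasurable] at hlim
  simp only [ProbabilityMeasure.coe_mk, integral_map (hVm' _) hf.aestronglyMeasurable, hcond]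
  rw [← tendsto_sub_nhds_zero_iff] at hlim ⊢
  refine (zero_add (0 : ℝ) ▸ (squeeze_zero_norm' ?_ hdev).add hlim).congr fun i =>
    sub_add_sub_cancel _ (∫ ω, f (V i ω) ∂P i) _
  filter_upwards [hw] with i hi
  have hWi : Integrable (W i) (P i) := .of_bound (hWm i).aestronglyMeasurable 1
    (.of_forall fun ω => by simpa [abs_of_nonneg (hW i ω).1] using (hW i ω).2)
  calc _ ≤ 2 * ‖f‖ * (∫ ω, |W i ω - w i| ∂P i) / w i :=
        abs_integral_mul_div_integral_sub_le (hf.comp_aemeasurable (hVm i)).aestronglyMeasurable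
          (fun ω => f.norm_coe_le_norm _) hWi (fun ω => (hW i ω).1) (hc.trans_le hi.1)
    _ ≤ 2 * ‖f‖ * (∫ ω, |W i ω - w i| ∂P i) / c := by
        gcongr
        exact hi.1

end ConvergenceInProbability

section WeakLaw

variable {Ω ι : Type*} [MeasurableSpace Ω] {P : Measure Ω} [IsProbabilityMeasure P]
  {Z : ι → Ω → ℝ} {s : Finset ι} {a b : ℝ}

lemma variance_expect_le (hZ : ∀ i ∈ s, AEMeasurable (Z i) P)
    (hind : (s : Set ι).Pairwise fun i j => Z i ⟂ᵢ[P] Z j)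
    (hab : ∀ i ∈ s, ∀ᵐ ω ∂P, Z i ω ∈ Set.Icc a b) :
    Var[fun ω => 𝔼 i ∈ s, Z i ω; P] ≤ ((b - a) / 2) ^ 2 / s.card := by
  have hL2 : ∀ i ∈ s, MemLp (Z i) 2 P := fun i hi =>
    memLp_of_bounded (hab i hi) (hZ i hi).aestronglyMeasurable 2
  have hexpect : (fun ω => 𝔼 i ∈ s, Z i ω) = fun ω => (s.card : ℝ)⁻¹ * (∑ i ∈ s, Z i) ω := by
    ext ω
    rw [Finset.expect_eq_sum_div_card, Finset.sum_apply, div_eq_inv_mul]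
  rw [hexpect, variance_const_mul, IndepFun.variance_sum hL2 hind]
  calc (s.card : ℝ)⁻¹ ^ 2 * ∑ i ∈ s, Var[Z i; P]
      ≤ (s.card : ℝ)⁻¹ ^ 2 * ∑ i ∈ s, ((b - a) / 2) ^ 2 := by
        gcongr with i hi
        exact variance_le_sq_of_bounded (hab i hi) (hZ i hi)
    _ = ((b - a) / 2) ^ 2 / s.card := by
        rw [Finset.sum_const, nsmul_eq_mul, div_eq_inv_mul]
        rcases eq_or_ne (s.card : ℝ) 0 with h | h
        · simp [h]
        · field_simp

lemma measureReal_lt_abs_expect_sub_le (hZ : ∀ i ∈ s, AEMeasurable (Z i) P)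
    (hind : (s : Set ι).Pairwise fun i j => Z i ⟂ᵢ[P] Z j)
    (hab : ∀ i ∈ s, ∀ᵐ ω ∂P, Z i ω ∈ Set.Icc a b) {δ : ℝ} (hδ : 0 < δ) :
    P.real {ω | δ < |𝔼 i ∈ s, Z i ω - 𝔼 i ∈ s, P[Z i]|} ≤
      ((b - a) / 2) ^ 2 / s.card / δ ^ 2 := by
  have hL2 : ∀ i ∈ s, MemLp (Z i) 2 P := fun i hi =>
    memLp_of_bounded (hab i hi) (hZ i hi).aestronglyMeasurable 2
  have hmean : 𝔼 i ∈ s, P[Z i] = P[fun ω => 𝔼 i ∈ s, Z i ω] := by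
    simp only [Finset.expect_eq_sum_div_card, integral_div]
    rw [integral_finsetSum _ fun i hi => (hL2 i hi).integrable one_le_two]
  have hexpect : MemLp (fun ω => 𝔼 i ∈ s, Z i ω) 2 P := by
    simp only [Finset.expect_eq_sum_div_card, div_eq_inv_mul]
    exact (memLp_finsetSum s hL2).const_mul _
  rw [hmean]
  refine ENNReal.toReal_le_of_le_ofReal (by positivity) ?_
  calc P {ω | δ < |𝔼 i ∈ s, Z i ω - P[fun ω => 𝔼 i ∈ s, Z i ω]|}
      ≤ P {ω | δ ≤ |𝔼 i ∈ s, Z i ω - P[fun ω => 𝔼 i ∈ s, Z i ω]|} :=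
        measure_mono (Set.ofPred_subset_ofPred.2 fun ω => le_of_lt)
    _ ≤ ENNReal.ofReal (Var[fun ω => 𝔼 i ∈ s, Z i ω; P] / δ ^ 2) :=
        meas_ge_le_variance_div_sq hexpect hδ
    _ ≤ ENNReal.ofReal (((b - a) / 2) ^ 2 / s.card / δ ^ 2) := by
        gcongr
        exact variance_expect_le hZ hind hab

end WeakLaw

section WeakLaw

variable {κ : Type*} {l : Filter κ} {Ω ι : κ → Type*} [∀ n, MeasurableSpace (Ω n)]
  {P : (n : κ) → Measure (Ω n)} [∀ n, IsProbabilityMeasure (P n)]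
  {Z : (n : κ) → ι n → Ω n → ℝ} {s : (n : κ) → Finset (ι n)} {a b : ℝ}

theorem tendstoZeroInProbability_expect_sub (hZ : ∀ n, ∀ i ∈ s n, AEMeasurable (Z n i) (P n))
    (hind : ∀ n, (s n : Set (ι n)).Pairwise fun i j => Z n i ⟂ᵢ[P n] Z n j)
    (hab : ∀ n, ∀ i ∈ s n, ∀ᵐ ω ∂P n, Z n i ω ∈ Set.Icc a b)
    (hs : Tendsto (fun n => (s n).card) l atTop) :
    TendstoZeroInProbability P
      (fun n ω => 𝔼 i ∈ s n, Z n i ω - 𝔼 i ∈ s n, (P n)[Z n i]) l := by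
  intro δ hδ
  have hlim := (((tendsto_natCast_atTop_atTop (R := ℝ)).comp hs).const_div_atTop
    (((b - a) / 2) ^ 2)).div_const (δ ^ 2)
  rw [zero_div] at hlim
  exact squeeze_zero (fun n => measureReal_nonneg)
    (fun n => measureReal_lt_abs_expect_sub_le (hZ n) (hind n) (hab n) hδ) hlim

end WeakLaw

section Bernoulli

variable {Ω : Type*} [MeasurableSpace Ω] {P : Measure Ω} {Y : Ω → Bool} {p : ℝ}

lemma measurable_ite_one_zero (hY : Measurable Y) :
    Measurable fun ω => if Y ω then (1 : ℝ) else 0 :=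
  (measurable_of_countable fun b : Bool => if b then (1 : ℝ) else 0).comp hY

lemma ite_one_zero_mem_Icc (b : Bool) : (if b then (1 : ℝ) else 0) ∈ Set.Icc (0 : ℝ) 1 := by
  cases b <;> simp

lemma integral_ite_one_zero (hY : Measurable Y) (hp : 0 ≤ p)
    (h : P {ω | Y ω = true} = ENNReal.ofReal p) : ∫ ω, (if Y ω then (1 : ℝ) else 0) ∂P = p := by
  have hm : MeasurableSet {ω | Y ω = true} := hY (measurableSet_singleton true)
  calc _ = ∫ ω, {ω | Y ω = true}.indicator 1 ω ∂P := by
        simp [Set.indicator_apply]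
    _ = P.real {ω | Y ω = true} := integral_indicator_one hm
    _ = p := by rw [measureReal_def, h, ENNReal.toReal_ofReal hp]

lemma variance_ite_one_zero [IsProbabilityMeasure P] (hY : Measurable Y) (hp : 0 ≤ p)
    (h : P {ω | Y ω = true} = ENNReal.ofReal p) :
    Var[fun ω => if Y ω then (1 : ℝ) else 0; P] = p * (1 - p) := by
  have hL2 : MemLp (fun ω => if Y ω then (1 : ℝ) else 0) 2 P :=
    memLp_of_bounded (.of_forall fun ω => ite_one_zero_mem_Icc (Y ω))
      (measurable_ite_one_zero hY).aestronglyMeasurable 2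
  have hsq : (fun ω => if Y ω then (1 : ℝ) else 0) ^ 2 = fun ω => if Y ω then (1 : ℝ) else 0 := by
    ext ω
    cases h : Y ω <;> simp [h]
  rw [variance_eq_sub hL2, hsq, integral_ite_one_zero hY hp h]
  ring

end Bernoulli

section ExponentialMechanism

variable {ι : Type*} [Fintype ι]

/-- The probability with which the exponential mechanism with temperature parameter `ε` draws `j`
when the score of `j'` is `g j'`. -/
def exponentialMechanism (ε : ℝ) (g : ι → ℝ) (j : ι) : ℝ :=
  Real.exp (ε * g j) / ∑ j', Real.exp (ε * g j')

lemma exponentialMechanism_pos (ε : ℝ) (g : ι → ℝ) (j : ι) : 0 < exponentialMechanism ε g j :=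
  div_pos (Real.exp_pos _) (Finset.sum_pos (fun _ _ => Real.exp_pos _) ⟨j, Finset.mem_univ j⟩)

lemma exponentialMechanism_le_one (ε : ℝ) (g : ι → ℝ) (j : ι) : exponentialMechanism ε g j ≤ 1 :=
  div_le_one_of_le₀ (Finset.single_le_sum (f := fun j' => Real.exp (ε * g j'))
    (fun _ _ => (Real.exp_pos _).le) (Finset.mem_univ j)) (by positivity)

lemma continuous_exponentialMechanism (ε : ℝ) (j : ι) :
    Continuous fun g : ι → ℝ => exponentialMechanism ε g j := by
  refine .div (by fun_prop) (by fun_prop) fun g => ?_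
  exact (Finset.sum_pos (fun _ _ => Real.exp_pos _) ⟨j, Finset.mem_univ j⟩).ne'

end ExponentialMechanism

/-- The gain of a split as a function of the relative size `q` of the first part and of the
proportions `x` in the region that is split, in its first part and in its second part. -/
def gainAt (I : ℝ → ℝ) (q : ℝ) (x : Fin 3 → ℝ) : ℝ :=
  I (x 0) - q * I (x 1) - (1 - q) * I (x 2)

section SelectionProbability

variable {d : ℕ} {k : Fin d → ℕ} {I : ℝ → ℝ} {a : ℝ}

lemma isOpen_setOf_forall_mem_Ioo :
    IsOpen {p : (NuisIdx k → ℝ) × (NuisIdx k → Fin 3 → ℝ) |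
      ∀ a i, p.2 a i ∈ Set.Ioo (0 : ℝ) 1} := by
  simp only [Set.ofPred_forall]
  exact isOpen_iInter_of_finite fun a => isOpen_iInter_of_finite fun i =>
    isOpen_Ioo.preimage (by fun_prop)

/-- The relative sizes in `[0, 1]` together with the proportions in `[a, 1 - a]`. -/
def sizePropBox (k : Fin d → ℕ) (a : ℝ) : Set ((NuisIdx k → ℝ) × (NuisIdx k → Fin 3 → ℝ)) :=
  Set.Icc 0 1 ×ˢ Set.Icc (fun _ _ => a) (fun _ _ => 1 - a)

lemma isCompact_sizePropBox : IsCompact (sizePropBox k a) :=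
  isCompact_Icc.prod isCompact_Icc

lemma sizePropBox_subset (ha : 0 < a) :
    sizePropBox k a ⊆ {p | ∀ a i, p.2 a i ∈ Set.Ioo (0 : ℝ) 1} := fun _ hp b i =>
  ⟨ha.trans_le (hp.2.1 b i), (hp.2.2 b i).trans_lt (sub_lt_self 1 ha)⟩

lemma continuousOn_gainAt (hI : ContinuousOn I (Set.Ioo 0 1)) :
    ContinuousOn (fun p : ℝ × (Fin 3 → ℝ) => gainAt I p.1 p.2)
      {p | ∀ i, p.2 i ∈ Set.Ioo (0 : ℝ) 1} := by
  have hcomp (i : Fin 3) : ContinuousOn (fun p : ℝ × (Fin 3 → ℝ) => I (p.2 i))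
      {p | ∀ i, p.2 i ∈ Set.Ioo (0 : ℝ) 1} := hI.comp (by fun_prop) fun p hp => hp i
  exact ((hcomp 0).sub (continuousOn_fst.mul (hcomp 1))).sub
    ((continuousOn_const.sub continuousOn_fst).mul (hcomp 2))

variable [∀ h, NeZero (k h)] {ε : Fin d → ℝ} {q : NuisIdx k → ℝ} {x : NuisIdx k → Fin 3 → ℝ}

/-- The probability that the exponential mechanism draws all the observed splits, as a function of
the relative sizes `q` and the proportions `x` of all candidate splits. -/
def selectionProb (I : ℝ → ℝ) (ε : Fin d → ℝ) (q : NuisIdx k → ℝ) (x : NuisIdx k → Fin 3 → ℝ) :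
    ℝ :=
  ∏ h, exponentialMechanism (ε h) (fun j => gainAt I (q ⟨h, j⟩) (x ⟨h, j⟩)) 0

lemma selectionProb_pos : 0 < selectionProb I ε q x :=
  Finset.prod_pos fun _ _ => exponentialMechanism_pos _ _ _

lemma selectionProb_le_one : selectionProb I ε q x ≤ 1 :=
  Finset.prod_le_one (fun _ _ => (exponentialMechanism_pos _ _ _).le)
    fun _ _ => exponentialMechanism_le_one _ _ _

lemma continuousOn_selectionProb (hI : ContinuousOn I (Set.Ioo 0 1)) :
    ContinuousOn (fun p : (NuisIdx k → ℝ) × (NuisIdx k → Fin 3 → ℝ) => selectionProb I ε p.1 p.2)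
      {p | ∀ a i, p.2 a i ∈ Set.Ioo (0 : ℝ) 1} := by
  have hgain (h : Fin d) (j : Fin (k h)) : ContinuousOn
      (fun p : (NuisIdx k → ℝ) × (NuisIdx k → Fin 3 → ℝ) => gainAt I (p.1 ⟨h, j⟩) (p.2 ⟨h, j⟩))
      {p | ∀ a i, p.2 a i ∈ Set.Ioo (0 : ℝ) 1} :=
    ContinuousOn.comp' (continuousOn_gainAt hI)
      (f := fun p : (NuisIdx k → ℝ) × (NuisIdx k → Fin 3 → ℝ) => (p.1 ⟨h, j⟩, p.2 ⟨h, j⟩))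
      (by fun_prop) fun p hp => hp ⟨h, j⟩
  exact continuousOn_finsetProd _ fun h _ =>
    (continuous_exponentialMechanism (ε h) 0).comp_continuousOn (continuousOn_pi.2 (hgain h))

lemma exists_forall_le_selectionProb (ε : Fin d → ℝ) (hI : ContinuousOn I (Set.Ioo 0 1))
    (ha : 0 < a) : ∃ c > 0, ∀ q x, (q, x) ∈ sizePropBox k a → c ≤ selectionProb I ε q x := by
  obtain ⟨c, hc, hle⟩ := isCompact_sizePropBox.exists_forall_le'
    ((continuousOn_selectionProb hI).mono (sizePropBox_subset ha))
    fun _ _ => selectionProb_pos (k := k)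
  exact ⟨c, hc, fun q x h => hle (q, x) h⟩

lemma exists_forall_abs_selectionProb_sub_le (ε : Fin d → ℝ) (hI : ContinuousOn I (Set.Ioo 0 1))
    (ha : 0 < a) {κ : ℝ} (hκ : 0 < κ) :
    ∃ δ > 0, ∀ p ∈ sizePropBox k a, ∀ x, (∀ b i, |x b i - p.2 b i| ≤ δ) →
      (∀ b i, x b i ∈ Set.Ioo (0 : ℝ) 1) ∧
        |selectionProb I ε p.1 x - selectionProb I ε p.1 p.2| ≤ κ := by
  have hunif := isCompact_sizePropBox.uniformContinuousAt_of_continuousAt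
    (fun p : (NuisIdx k → ℝ) × (NuisIdx k → Fin 3 → ℝ) => selectionProb I ε p.1 p.2)
    (fun p hp => (continuousOn_selectionProb hI).continuousAt
      (isOpen_setOf_forall_mem_Ioo.mem_nhds (sizePropBox_subset ha hp)))
    (Metric.dist_mem_uniformity hκ)
  obtain ⟨η, hη, hclose⟩ := Metric.mem_uniformity_dist.1 hunif
  refine ⟨min η a / 2, by positivity, fun p hp x hx => ⟨fun b i => ?_, ?_⟩⟩
  · have hδ : min η a / 2 < a := (half_lt_self (by positivity)).trans_le (min_le_right _ _)
    have h := abs_le.1 (hx b i)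
    exact ⟨by linarith [hp.2.1 b i], by linarith [hp.2.2 b i]⟩
  · have hδ : min η a / 2 < η := (half_lt_self (by positivity)).trans_le (min_le_left _ _)
    have hdist : dist x p.2 ≤ min η a / 2 := by
      refine (dist_pi_le_iff (by positivity)).2 fun b => (dist_pi_le_iff (by positivity)).2 ?_
      exact hx b
    have hpx : dist p (p.1, x) < η := by
      rw [Prod.dist_eq, dist_self, max_eq_right dist_nonneg, dist_comm]
      exact hdist.trans_lt hδ
    rw [abs_sub_comm]
    exact (show |_| < κ from hclose hpx hp).le

end SelectionProbability

section Samples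

variable {𝒳 : Type*} {n : ℕ} (X : Fin n → 𝒳)

open Classical in
/-- The indices of the sample points that lie in the region `R`. -/
def samplesIn (R : Set 𝒳) : Finset (Fin n) := {i | X i ∈ R}

lemma mem_samplesIn {R : Set 𝒳} {i : Fin n} : i ∈ samplesIn X R ↔ X i ∈ R := by
  simp [samplesIn]

lemma card_samplesIn (R : Set 𝒳) : (samplesIn X R).card = count X R := by
  rw [count, ← Set.ncard_coe_finset]
  congr 1
  ext i
  simp [mem_samplesIn]

lemma samplesIn_diff {R L : Set 𝒳} : samplesIn X (R \ L) = samplesIn X R \ samplesIn X L := by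
  ext i
  simp [mem_samplesIn]

lemma samplesIn_mono {R R' : Set 𝒳} (h : R ⊆ R') : samplesIn X R ⊆ samplesIn X R' :=
  fun _ hi => (mem_samplesIn X).2 (h ((mem_samplesIn X).1 hi))

lemma count_mono {R R' : Set 𝒳} (h : R ⊆ R') : count X R ≤ count X R' := by
  simpa only [card_samplesIn] using Finset.card_le_card (samplesIn_mono X h)

lemma prop_eq_expect (y : Fin n → Bool) (R : Set 𝒳) :
    prop X y R = 𝔼 i ∈ samplesIn X R, if y i then (1 : ℝ) else 0 := by
  classical
  rw [prop, Finset.expect_eq_sum_div_card, card_samplesIn, samplesIn, Finset.sum_filter,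
    one_div, inv_mul_eq_div]
  simp [Set.indicator_apply]

lemma count_mul_prop (y : Fin n → Bool) (R : Set 𝒳) :
    count X R * prop X y R = ∑ i ∈ samplesIn X R, if y i then (1 : ℝ) else 0 := by
  rw [prop_eq_expect, ← card_samplesIn, Finset.card_mul_expect]

lemma count_diff {P Q : Set 𝒳} (h : Q ⊆ P) :
    (count X (P \ Q) : ℝ) = count X P - count X Q := by
  rw [← card_samplesIn, ← card_samplesIn, ← card_samplesIn, samplesIn_diff,
    Finset.cast_card_sdiff (samplesIn_mono X h)]

lemma count_mul_prop_diff {P Q : Set 𝒳} (h : Q ⊆ P) (y : Fin n → Bool) :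
    count X (P \ Q) * prop X y (P \ Q) = count X P * prop X y P - count X Q * prop X y Q := by
  simp only [count_mul_prop]
  rw [samplesIn_diff, eq_sub_iff_add_eq, Finset.sum_sdiff (samplesIn_mono X h)]

end Samples

section Tree

variable {𝒳 : Type*} {d m : ℕ} {k : Fin d → ℕ} [NeZero m] [∀ h, NeZero (k h)]

namespace TreeFit

variable (t : TreeFit 𝒳 d m k)

/-- The three regions of the candidate split `a`: the region that is split and its two parts. -/
def splitRegion (a : NuisIdx k) : Fin 3 → Set 𝒳 :=
  ![t.node a.1.castSucc, t.child a.1 a.2, t.node a.1.castSucc \ t.child a.1 a.2]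

/-- All regions on which the pivot depends: the first leaf and those of the candidate splits. -/
def pathRegion : Option (NuisIdx k × Fin 3) → Set 𝒳
  | none => t.leaf 0
  | some (a, i) => t.splitRegion a i

lemma leaf_subset_node (i : Fin (d + 1)) : t.leaf 0 ⊆ t.node i := by
  induction i using Fin.reverseInduction with
  | last => exact t.node_last.ge
  | cast h ih => exact (ih.trans (t.child_zero h).ge).trans (t.child_subset h 0)

lemma theta_eq (π : Fin m → ℝ) {x : 𝒳} {j : Fin m} (hx : x ∈ t.leaf j) : t.theta π x = π j := by
  rw [TreeFit.theta, Finset.sum_eq_single j]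
  · simp [hx]
  · intro i _ hij
    simp [Set.disjoint_right.1 (t.leaf_disjoint hij) hx]
  · simp

lemma theta_mem {π : Fin m → ℝ} {s : Set ℝ} (hπ : ∀ j, π j ∈ s) (x : 𝒳) : t.theta π x ∈ s := by
  obtain ⟨j, hj⟩ := Set.mem_iUnion.1 (t.leaf_cover ▸ Set.mem_univ x)
  exact t.theta_eq π hj ▸ hπ j

end TreeFit

variable (t : TreeFit 𝒳 d m k) {n : ℕ} (X : Fin n → 𝒳) (y : Fin n → Bool)

/-- The relative size of the first part of each candidate split. -/
def relSize (a : NuisIdx k) : ℝ :=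
  (count X (t.child a.1 a.2) : ℝ) / count X (t.node a.1.castSucc)

lemma relSize_mem_Icc : relSize t X ∈ Set.Icc 0 1 :=
  ⟨fun _ => by simp only [relSize, Pi.zero_apply]; positivity, fun a =>
    div_le_one_of_le₀ (Nat.cast_le.2 (count_mono X (t.child_subset a.1 a.2))) (Nat.cast_nonneg _)⟩

section Orthogonalization

variable {P Q R : Set 𝒳}

/-- The slope with which the proportion in the region `R` depends on the main statistic when the
orthogonalized proportion of `R` is fixed, `L` being the first leaf. -/
def leafSlope (L R : Set 𝒳) : ℝ := (count X (R ∩ L) : ℝ) / (count X R * √(count X L))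

lemma leafSlope_mul_sqrt_mem_Icc (L R : Set 𝒳) :
    leafSlope X L R * √(count X L) ∈ Set.Icc (0 : ℝ) 1 := by
  have hle : (count X (R ∩ L) : ℝ) ≤ count X R :=
    Nat.cast_le.2 (count_mono X Set.inter_subset_left)
  refine ⟨by unfold leafSlope; positivity, ?_⟩
  rw [leafSlope, div_mul_eq_mul_div]
  exact div_le_one_of_le₀ (by gcongr) (by positivity)

lemma count_mul_leafSlope {L R : Set 𝒳} (hR : 0 < count X R) :
    count X R * leafSlope X L R = count X (R ∩ L) / √(count X L) := by
  rw [leafSlope]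
  field_simp

lemma leafSlope_of_subset {L R : Set 𝒳} (h : L ⊆ R) :
    leafSlope X L R = √(count X L) / count X R := by
  rw [leafSlope, Set.inter_eq_right.2 h, mul_comm, ← div_div, Real.div_sqrt]

lemma leafSlope_diff {L : Set 𝒳} (h : Q ⊆ P) :
    leafSlope X L (P \ Q) =
      (count X (P ∩ L) - count X (Q ∩ L)) / ((count X P - count X Q) * √(count X L)) := by
  rw [leafSlope, ← count_diff X h, ← count_diff X (Set.inter_subset_inter_left L h)]
  congr 3
  ext x
  simp
  tauto

lemma count_mul_leafSlope_diff {L : Set 𝒳} (h : Q ⊆ P) (hP : 0 < count X P) (hQ : 0 < count X Q)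
    (hPQ : 0 < count X (P \ Q)) :
    count X (P \ Q) * leafSlope X L (P \ Q) =
      count X P * leafSlope X L P - count X Q * leafSlope X L Q := by
  rw [count_mul_leafSlope X hP, count_mul_leafSlope X hQ, leafSlope_diff X h, ← count_diff X h]
  field_simp

lemma orthStat_eq_sqrt_mul :
    orthStat t X y R =
      √(count X R) * (prop X y R - leafSlope X (t.leaf 0) R * mainStat t X y) := by
  have hslope : √(count X R) * leafSlope X (t.leaf 0) R =
      count X (R ∩ t.leaf 0) / √((count X (t.leaf 0) : ℝ) * count X R) := by
    rw [leafSlope, Real.sqrt_mul (Nat.cast_nonneg _), mul_div_left_comm, ← div_div,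
      Real.sqrt_div_self, inv_eq_one_div, div_div, mul_one_div, mul_comm √_]
  rw [mul_sub, ← mul_assoc, hslope, orthStat, mainStat]

/-- The proportions in the region of a split with scaling vector `η` and in its two parts, as a
function of three key statistics. -/
def etaProps (η : Fin 8 → ℝ) (p : ℝ × ℝ × ℝ) : Fin 3 → ℝ :=
  ![η 0 * p.1 + η 1 * p.2.1, η 2 * p.1 + η 3 * p.2.2, η 4 * p.1 + η 5 * p.2.1 + η 6 * p.2.2]

lemma mem_gainDomain_iff {η : Fin 8 → ℝ} {p : ℝ × ℝ × ℝ} :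
    p ∈ gainDomain η ↔ ∀ i, etaProps η p i ∈ Set.Ioo (0 : ℝ) 1 := by
  simp [gainDomain, etaProps, Fin.forall_fin_succ]

lemma etaProps_eta_orthStat (hLP : t.leaf 0 ⊆ P) (hQP : Q ⊆ P) (hP : 0 < count X P)
    (hQ : 0 < count X Q) (hPQ : 0 < count X (P \ Q)) (u : ℝ) (i : Fin 3) :
    etaProps (eta X (t.leaf 0) P Q) (u, orthStat t X y P, orthStat t X y Q) i =
      prop X y (![P, Q, P \ Q] i) +
        leafSlope X (t.leaf 0) (![P, Q, P \ Q] i) * (u - mainStat t X y) := by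
  have hnode := orthStat_eq_sqrt_mul t X y (R := P)
  have hchild := orthStat_eq_sqrt_mul t X y (R := Q)
  have hsq (R : Set 𝒳) : √(count X R : ℝ) * √(count X R) = count X R :=
    Real.mul_self_sqrt (Nat.cast_nonneg _)
  fin_cases i
  · simp only [etaProps, eta, Matrix.cons_val, Fin.zero_eta, leafSlope_of_subset X hLP, hnode]
    field_simp
    ring
  · simp only [etaProps, eta, Matrix.cons_val, Fin.mk_one, hchild]
    change leafSlope X (t.leaf 0) Q * u + _ = _
    field_simp
    ring
  · have hD : (0 : ℝ) < count X P - count X Q := by rw [← count_diff X hQP]; positivity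
    have hprop := count_mul_prop_diff X hQP y
    have hslope := count_mul_leafSlope_diff X (L := t.leaf 0) hQP hP hQ hPQ
    have hslope' := leafSlope_diff X (L := t.leaf 0) hQP
    simp only [etaProps, eta, Matrix.cons_val, Fin.reduceFinMk, hnode, hchild, ← hslope']
    rw [count_diff X hQP] at hprop hslope
    field_simp
    linear_combination (prop X y P - leafSlope X (t.leaf 0) P * mainStat t X y) * hsq P -
      (prop X y Q - leafSlope X (t.leaf 0) Q * mainStat t X y) * hsq Q - hprop +
        mainStat t X y * hslope

end Orthogonalization

/-- The proportions in the regions of all candidate splits, as a function of the key statistics. -/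
def pathProps (u : ℝ) (v : NuisIdx k → ℝ) (a : NuisIdx k) : Fin 3 → ℝ :=
  etaProps (splitEta t X a.1 a.2) (splitArgs u v a.1 a.2)

lemma mem_statDomain_iff {u : ℝ} {v : NuisIdx k → ℝ} :
    (u, v) ∈ statDomain t X ↔ ∀ a i, pathProps t X u v a i ∈ Set.Ioo (0 : ℝ) 1 := by
  simp only [statDomain, Set.mem_ofPred_eq, mem_gainDomain_iff, Sigma.forall, pathProps]

lemma prod_lambda_eq_selectionProb (I : ℝ → ℝ) (ε : Fin d → ℝ) {u : ℝ} {v : NuisIdx k → ℝ}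
    (h : (u, v) ∈ statDomain t X) :
    ∏ h, lambda I ε t X h u v = selectionProb I ε (relSize t X) (pathProps t X u v) :=
  Finset.prod_congr rfl fun _ _ => if_pos h

lemma gain_eq_gainAt (I : ℝ → ℝ) {P Q : Set 𝒳} (hQP : Q ⊆ P) (hP : 0 < count X P) :
    gain I X y P Q =
      gainAt I (count X Q / count X P) ![prop X y P, prop X y Q, prop X y (P \ Q)] := by
  have hcompl : (count X (P \ Q) : ℝ) / count X P = 1 - count X Q / count X P := by
    rw [count_diff X hQP, sub_div, div_self (by positivity)]
  simp only [gain, gainAt, Matrix.cons_val, hcompl]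
  ring

/-- The probability with which the observed splits are drawn, given the outcomes `y`. -/
def observedProb (I : ℝ → ℝ) (ε : Fin d → ℝ) (t : TreeFit 𝒳 d m k) (X : Fin n → 𝒳)
    (y : Fin n → Bool) : ℝ :=
  ∏ h, splitProb I (ε h) X y (t.node h.castSucc) (t.child h) 0

lemma observedProb_eq_selectionProb (I : ℝ → ℝ) (ε : Fin d → ℝ)
    (hcount : ∀ h : Fin d, 0 < count X (t.node h.castSucc)) :
    observedProb I ε t X y =
      selectionProb I ε (relSize t X) fun a i => prop X y (t.splitRegion a i) := by
  refine Finset.prod_congr rfl fun h _ => ?_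
  have hgain (j : Fin (k h)) : gain I X y (t.node h.castSucc) (t.child h j) =
      gainAt I (relSize t X ⟨h, j⟩) fun i => prop X y (t.splitRegion ⟨h, j⟩ i) := by
    rw [gain_eq_gainAt X y I (t.child_subset h j) (hcount _)]
    congr 1
    ext i
    fin_cases i <;> rfl
  simp only [splitProb, exponentialMechanism, hgain]

lemma splitProb_mem_Ioc (I : ℝ → ℝ) (ε : ℝ) {l : ℕ} (P : Set 𝒳) (Q : Fin l → Set 𝒳) (s : Fin l) :
    splitProb I ε X y P Q s ∈ Set.Ioc (0 : ℝ) 1 :=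
  ⟨exponentialMechanism_pos ε (fun s' => gain I X y P (Q s')) s,
    exponentialMechanism_le_one ε (fun s' => gain I X y P (Q s')) s⟩

lemma observedProb_mem_Ioc (I : ℝ → ℝ) (ε : Fin d → ℝ) :
    observedProb I ε t X y ∈ Set.Ioc (0 : ℝ) 1 := by
  have hsplit (h : Fin d) := splitProb_mem_Ioc X y I (ε h) (t.node h.castSucc) (t.child h) 0
  exact ⟨Finset.prod_pos fun h _ => (hsplit h).1,
    Finset.prod_le_one (fun h _ => (hsplit h).1.le) fun h _ => (hsplit h).2⟩

lemma nodeCoord_nuisStat (i : Fin (d + 1)) :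
    nodeCoord (nuisStat t X y) i = orthStat t X y (t.node i) := by
  induction i using Fin.lastCases with
  | last =>
    rw [nodeCoord, Fin.lastCases_last, t.node_last, orthStat_eq_sqrt_mul,
      leafSlope_of_subset X subset_rfl, mainStat, ← mul_assoc, div_mul_eq_mul_div,
      Real.mul_self_sqrt (Nat.cast_nonneg _)]
    rcases Nat.eq_zero_or_pos (count X (t.leaf 0)) with h | h
    · simp [h]
    · rw [div_self (by positivity), one_mul, sub_self, mul_zero]
  | cast h => simp [nodeCoord, nuisStat, TreeFit.region]

lemma splitArgs_nuisStat (u : ℝ) (h : Fin d) (j : Fin (k h)) :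
    splitArgs u (nuisStat t X y) h j =
      (u, orthStat t X y (t.node h.castSucc), orthStat t X y (t.child h j)) := by
  rw [splitArgs, nodeCoord_nuisStat, nodeCoord_nuisStat]
  split_ifs with hj
  · rw [hj, t.child_zero]
  · simp [nuisStat, TreeFit.region, hj]

variable {t X y}

lemma pathProps_nuisStat (hcount : ∀ a i, 0 < count X (t.splitRegion a i)) (u : ℝ)
    (a : NuisIdx k) (i : Fin 3) :
    pathProps t X u (nuisStat t X y) a i = prop X y (t.splitRegion a i) +
      leafSlope X (t.leaf 0) (t.splitRegion a i) * (u - mainStat t X y) := by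
  rw [pathProps, splitArgs_nuisStat]
  exact etaProps_eta_orthStat t X y (t.leaf_subset_node _) (t.child_subset _ _) (hcount a 0)
    (hcount a 1) (hcount a 2) u i

lemma abs_pathProps_nuisStat_sub_le (hcount : ∀ a i, 0 < count X (t.splitRegion a i))
    {x : NuisIdx k → Fin 3 → ℝ} {p u δ : ℝ} (hp : |prop X y (t.leaf 0) - p| ≤ δ)
    (hx : ∀ a i, |prop X y (t.splitRegion a i) - x a i| ≤ δ)
    (hu : |u - √(count X (t.leaf 0)) * p| ≤ δ * √(count X (t.leaf 0))) (a : NuisIdx k) (i : Fin 3) :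
    |pathProps t X u (nuisStat t X y) a i - x a i| ≤ 3 * δ := by
  set N : ℝ := √(count X (t.leaf 0))
  set s := leafSlope X (t.leaf 0) (t.splitRegion a i)
  have hs : s * N ∈ Set.Icc (0 : ℝ) 1 := leafSlope_mul_sqrt_mem_Icc X _ _
  have hs0 : 0 ≤ s := by simp only [s, leafSlope]; positivity
  have hleaf : |s * N * (prop X y (t.leaf 0) - p)| ≤ δ := by
    rw [abs_mul, abs_of_nonneg hs.1]
    exact (mul_le_of_le_one_left (abs_nonneg _) hs.2).trans hp
  have hshift : |s * (u - N * p)| ≤ δ := by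
    rw [abs_mul, abs_of_nonneg hs0]
    calc s * |u - N * p| ≤ s * N * δ := by rw [mul_assoc, mul_comm N δ]; gcongr
      _ ≤ δ := mul_le_of_le_one_left ((abs_nonneg _).trans hp) hs.2
  calc |pathProps t X u (nuisStat t X y) a i - x a i|
      = |(prop X y (t.splitRegion a i) - x a i) + s * (u - N * p) -
          s * N * (prop X y (t.leaf 0) - p)| := by
        rw [pathProps_nuisStat hcount, mainStat]
        congr 1
        ring
    _ ≤ δ + δ + δ := (abs_sub _ _).trans
        (add_le_add ((abs_add_le _ _).trans (add_le_add (hx a i) hshift)) hleaf)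
    _ = 3 * δ := by ring

end Tree

section Pivot

variable {𝒳 : Type*} {d m : ℕ} {k : Fin d → ℕ} [NeZero m] [∀ h, NeZero (k h)] {I : ℝ → ℝ}
  (ε : Fin d → ℝ) (t : TreeFit 𝒳 d m k) {n : ℕ} (X : Fin n → 𝒳)

lemma continuous_pathProps (v : NuisIdx k → ℝ) : Continuous fun u => pathProps t X u v := by
  refine continuous_pi fun a => continuous_pi fun i => ?_
  fin_cases i <;> simp only [pathProps, etaProps, splitArgs, Matrix.cons_val, Fin.zero_eta,
    Fin.mk_one, Fin.reduceFinMk] <;> fun_prop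

open Classical in
lemma lambda_eq_ite (h : Fin d) (u : ℝ) (v : NuisIdx k → ℝ) :
    lambda I ε t X h u v = if (u, v) ∈ statDomain t X then exponentialMechanism (ε h)
      (fun j => gainAt I (relSize t X ⟨h, j⟩) (pathProps t X u v ⟨h, j⟩)) 0 else 0 :=
  rfl

lemma lambda_mem_Icc (h : Fin d) (u : ℝ) (v : NuisIdx k → ℝ) :
    lambda I ε t X h u v ∈ Set.Icc (0 : ℝ) 1 := by
  rw [lambda_eq_ite]
  split_ifs
  · exact ⟨(exponentialMechanism_pos _ _ _).le, exponentialMechanism_le_one _ _ _⟩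
  · exact ⟨le_rfl, zero_le_one⟩

lemma measurable_lambda (hI : ContinuousOn I (Set.Ioo 0 1)) (h : Fin d) (v : NuisIdx k → ℝ) :
    Measurable fun u => lambda I ε t X h u v := by
  classical
  have hprops := continuous_pathProps t X v
  have hopen : IsOpen {u | (u, v) ∈ statDomain t X} := by
    simp only [mem_statDomain_iff, Set.ofPred_forall]
    exact isOpen_iInter_of_finite fun a => isOpen_iInter_of_finite fun i =>
      isOpen_Ioo.preimage (by fun_prop)
  have hgain (j : Fin (k h)) : ContinuousOn
      (fun u => gainAt I (relSize t X ⟨h, j⟩) (pathProps t X u v ⟨h, j⟩))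
      {u | (u, v) ∈ statDomain t X} :=
    ContinuousOn.comp' (continuousOn_gainAt hI)
      (f := fun u => (relSize t X ⟨h, j⟩, pathProps t X u v ⟨h, j⟩)) (by fun_prop)
      fun u hu => (mem_statDomain_iff t X).1 hu ⟨h, j⟩
  simp only [lambda_eq_ite]
  exact ((continuous_exponentialMechanism (ε h) 0).comp_continuousOn
    (continuousOn_pi.2 hgain)).measurable_piecewise continuousOn_const hopen.measurableSet

variable {ε t X} {y : Fin n → Bool}

lemma abs_pivot_sub_cdf_le (hI : ContinuousOn I (Set.Ioo 0 1)) {p w κ M : ℝ}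
    (hp : p ∈ Set.Ioo (0 : ℝ) 1) (hw0 : 0 < w) (hw1 : w ≤ 1) (hκ : 0 ≤ κ) (hM : 0 < M)
    (hT : |mainStat t X y - √(count X (t.leaf 0)) * p| ≤ M)
    (hnear : ∀ u, |u - √(count X (t.leaf 0)) * p| ≤ M → (u, nuisStat t X y) ∈ statDomain t X ∧
      |∏ h, lambda I ε t X h u (nuisStat t X y) - w| ≤ κ) :
    |pivot I ε t X p y - cdf (gaussianReal (√(count X (t.leaf 0)) * p) (p * (1 - p)).toNNReal)
      (mainStat t X y)| ≤ 2 * (κ + p * (1 - p) / M ^ 2) / w := by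
  have hvar : 0 < p * (1 - p) := mul_pos hp.1 (sub_pos.2 hp.2)
  have h := abs_reweighted_cdf_gaussianReal_sub_le (Real.toNNReal_pos.2 hvar).ne'
    (Finset.measurable_fun_prod _ fun h _ => measurable_lambda ε t X hI h (nuisStat t X y))
    (fun u => ⟨Finset.prod_nonneg fun h _ => (lambda_mem_Icc ε t X h u _).1,
      Finset.prod_le_one (fun h _ => (lambda_mem_Icc ε t X h u _).1)
        fun h _ => (lambda_mem_Icc ε t X h u _).2⟩)
    hw0 hw1 hκ hM (fun u hu => (hnear u hu).2) (mainStat t X y)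
  rw [Real.coe_toNNReal _ hvar.le] at h
  rwa [pivot, pivotFun, if_pos (hnear _ hT).1]

end Pivot

section Means

variable {𝒳 : Type*} {d m : ℕ} {k : Fin d → ℕ} [NeZero m] [∀ h, NeZero (k h)]
  (t : TreeFit 𝒳 d m k) {n : ℕ} (X : Fin n → 𝒳)

/-- The means of the proportions in the regions on which the pivot depends. -/
def pathMean (π : Fin m → ℝ) (r : Option (NuisIdx k × Fin 3)) : ℝ :=
  𝔼 i ∈ samplesIn X (t.pathRegion r), t.theta π (X i)

variable {t X} {π : Fin m → ℝ} {a b : ℝ} {r : Option (NuisIdx k × Fin 3)}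

lemma samplesIn_nonempty {R : Set 𝒳} (hR : 0 < count X R) : (samplesIn X R).Nonempty :=
  Finset.card_pos.1 (card_samplesIn X R ▸ hR)

lemma pathMean_mem_Icc (hπ : ∀ j, π j ∈ Set.Icc a b) (hr : 0 < count X (t.pathRegion r)) :
    pathMean t X π r ∈ Set.Icc a b :=
  ⟨Finset.le_expect (samplesIn_nonempty hr) fun i _ => (t.theta_mem hπ (X i)).1,
    Finset.expect_le (samplesIn_nonempty hr) fun i _ => (t.theta_mem hπ (X i)).2⟩

lemma pathMean_none (hr : 0 < count X (t.leaf 0)) : pathMean t X π none = π 0 := by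
  have hconst : ∀ i ∈ samplesIn X (t.leaf 0), t.theta π (X i) = π 0 := fun i hi =>
    t.theta_eq π ((mem_samplesIn X).1 hi)
  exact (Finset.expect_congr rfl hconst).trans (Finset.expect_const (samplesIn_nonempty hr) _)

end Means

section Asymptotics

variable {𝒳 : Type*} {d m : ℕ} {k : Fin d → ℕ} [NeZero m] [∀ h, NeZero (k h)]
  {X : (n : ℕ) → Fin n → 𝒳} {t : ℕ → TreeFit 𝒳 d m k} {π : ℕ → Fin m → ℝ}
  {Ω : ℕ → Type*} [∀ n, MeasurableSpace (Ω n)] {P : (n : ℕ) → Measure (Ω n)}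
  [∀ n, IsProbabilityMeasure (P n)] {Y : (n : ℕ) → Fin n → Ω n → Bool}
  {I : ℝ → ℝ} {a : ℝ}

lemma tendstoZeroInProbability_prop_sub_pathMean (hπ : ∀ n j, 0 ≤ π n j)
    (hYm : ∀ n i, Measurable (Y n i)) (hYind : ∀ n, iIndepFun (Y n) (P n))
    (hYlaw : ∀ n i, P n {ω | Y n i ω = true} = ENNReal.ofReal ((t n).theta (π n) (X n i)))
    {r : Option (NuisIdx k × Fin 3)}
    (hcount : Tendsto (fun n => count (X n) ((t n).pathRegion r)) atTop atTop) :
    TendstoZeroInProbability P (fun n ω => prop (X n) (fun i => Y n i ω) ((t n).pathRegion r) -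
      pathMean (t n) (X n) (π n) r) atTop := by
  have hwlln := tendstoZeroInProbability_expect_sub (P := P) (l := atTop)
    (s := fun n => samplesIn (X n) ((t n).pathRegion r))
    (Z := fun n i ω => if Y n i ω then (1 : ℝ) else 0)
    (fun n i _ => (measurable_ite_one_zero (hYm n i)).aemeasurable)
    (fun n i _ j _ hij => ((hYind n).indepFun hij).comp (measurable_of_countable fun b : Bool =>
      if b then (1 : ℝ) else 0) (measurable_of_countable fun b : Bool => if b then (1 : ℝ) else 0))
    (fun n i _ => .of_forall fun ω => ite_one_zero_mem_Icc (Y n i ω))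
    (by simpa only [card_samplesIn] using hcount)
  have hmean (n : ℕ) (i : Fin n) : (P n)[fun ω => if Y n i ω then (1 : ℝ) else 0] =
      (t n).theta (π n) (X n i) :=
    integral_ite_one_zero (hYm n i) ((t n).theta_mem (s := Set.Ici 0) (hπ n) _) (hYlaw n i)
  simpa only [hmean, pathMean, ← prop_eq_expect] using hwlln

/-- The probability of the observed splits when the proportions are replaced by their means. -/
def meanSelectionProb (I : ℝ → ℝ) (ε : Fin d → ℝ) {n : ℕ} (t : TreeFit 𝒳 d m k) (X : Fin n → 𝒳)
    (π : Fin m → ℝ) : ℝ :=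
  selectionProb I ε (relSize t X) fun b i => pathMean t X π (some (b, i))

lemma eventually_mem_sizePropBox (hπa : ∀ᶠ n in atTop, ∀ j, π n j ∈ Set.Icc a (1 - a))
    (hcount : ∀ r, Tendsto (fun n => count (X n) ((t n).pathRegion r)) atTop atTop) :
    ∀ᶠ n in atTop, (relSize (t n) (X n), fun b i => pathMean (t n) (X n) (π n) (some (b, i))) ∈
      sizePropBox k a := by
  filter_upwards [hπa, eventually_all.2 fun r => (hcount r).eventually_gt_atTop 0] with n hπn hn
  have h (b : NuisIdx k) (i : Fin 3) := pathMean_mem_Icc hπn (hn (some (b, i)))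
  exact ⟨relSize_mem_Icc _ _, fun b i => (h b i).1, fun b i => (h b i).2⟩

lemma exists_eventually_meanSelectionProb_mem_Icc (ε : Fin d → ℝ)
    (hI : ContinuousOn I (Set.Ioo 0 1)) (ha : 0 < a)
    (hπa : ∀ᶠ n in atTop, ∀ j, π n j ∈ Set.Icc a (1 - a))
    (hcount : ∀ r, Tendsto (fun n => count (X n) ((t n).pathRegion r)) atTop atTop) :
    ∃ c > 0, ∀ᶠ n in atTop, meanSelectionProb I ε (t n) (X n) (π n) ∈ Set.Icc c 1 := by
  obtain ⟨c, hc, hcw⟩ := exists_forall_le_selectionProb (k := k) ε hI ha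
  refine ⟨c, hc, ?_⟩
  filter_upwards [eventually_mem_sizePropBox hπa hcount] with n hn
  exact ⟨hcw _ _ hn, selectionProb_le_one⟩

lemma tendstoZeroInProbability_observedProb_sub (ε : Fin d → ℝ)
    (hI : ContinuousOn I (Set.Ioo 0 1)) (ha : 0 < a)
    (hπa : ∀ᶠ n in atTop, ∀ j, π n j ∈ Set.Icc a (1 - a))
    (hcount : ∀ r, Tendsto (fun n => count (X n) ((t n).pathRegion r)) atTop atTop)
    (hdev : ∀ r, TendstoZeroInProbability P (fun n ω =>
      prop (X n) (fun i => Y n i ω) ((t n).pathRegion r) - pathMean (t n) (X n) (π n) r) atTop) :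
    TendstoZeroInProbability P (fun n ω =>
      observedProb I ε (t n) (X n) (fun i => Y n i ω) - meanSelectionProb I ε (t n) (X n) (π n))
      atTop := by
  refine .of_forall_abs_le_imp hdev fun κ hκ => ?_
  obtain ⟨δ, hδ, hsel⟩ := exists_forall_abs_selectionProb_sub_le (k := k) ε hI ha hκ
  refine ⟨δ, hδ, ?_⟩
  filter_upwards [eventually_mem_sizePropBox hπa hcount,
    eventually_all.2 fun r => (hcount r).eventually_gt_atTop 0] with n hbox hpos ω hω
  rw [observedProb_eq_selectionProb _ _ _ _ _ fun h => hpos (some (⟨h, 0⟩, 0))]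
  exact (hsel _ hbox _ fun b i => hω (some (b, i))).2

lemma tendstoZeroInProbability_pivot_sub_cdf (ε : Fin d → ℝ)
    (hI : ContinuousOn I (Set.Ioo 0 1)) (ha : 0 < a)
    (hπa : ∀ᶠ n in atTop, ∀ j, π n j ∈ Set.Icc a (1 - a))
    (hcount : ∀ r, Tendsto (fun n => count (X n) ((t n).pathRegion r)) atTop atTop)
    (hdev : ∀ r, TendstoZeroInProbability P (fun n ω =>
      prop (X n) (fun i => Y n i ω) ((t n).pathRegion r) - pathMean (t n) (X n) (π n) r) atTop) :
    TendstoZeroInProbability P (fun n ω =>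
      pivot I ε (t n) (X n) (π n 0) (fun i => Y n i ω) -
        cdf (gaussianReal (√(count (X n) ((t n).leaf 0)) * π n 0)
          (π n 0 * (1 - π n 0)).toNNReal) (mainStat (t n) (X n) fun i => Y n i ω)) atTop := by
  refine .of_forall_abs_le_imp hdev fun κ hκ => ?_
  obtain ⟨c, hc, hcw⟩ := exists_eventually_meanSelectionProb_mem_Icc ε hI ha hπa hcount
  have hκ' : 0 < c * κ / 4 := by positivity
  obtain ⟨δ, hδ, hsel⟩ := exists_forall_abs_selectionProb_sub_le (k := k) ε hI ha hκ'
  have hlarge : ∀ᶠ n in atTop, 1 ≤ c * κ / 4 * (δ / 3) ^ 2 * count (X n) ((t n).leaf 0) :=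
    ((tendsto_natCast_atTop_atTop.comp (hcount none)).const_mul_atTop
      (by positivity)).eventually_ge_atTop 1
  refine ⟨δ / 3, by positivity, ?_⟩
  filter_upwards [hcw, eventually_mem_sizePropBox hπa hcount, hπa, hlarge,
    eventually_all.2 fun r => (hcount r).eventually_gt_atTop 0] with n hw hbox hπn hN hpos ω hω
  have hp : π n 0 ∈ Set.Ioo (0 : ℝ) 1 :=
    ⟨ha.trans_le (hπn 0).1, (hπn 0).2.trans_lt (sub_lt_self 1 ha)⟩
  have hL : 0 < count (X n) ((t n).leaf 0) := hpos none
  have hleaf : |prop (X n) (fun i => Y n i ω) ((t n).leaf 0) - π n 0| ≤ δ / 3 :=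
    pathMean_none (π := π n) hL ▸ hω none
  refine (abs_pivot_sub_cdf_le hI hp (hc.trans_le hw.1) hw.2 hκ'.le
    (M := δ / 3 * √(count (X n) ((t n).leaf 0))) (by positivity) ?_ fun u hu => ?_).trans ?_
  · rw [mainStat, ← mul_sub, abs_mul, abs_of_nonneg (by positivity), mul_comm]
    gcongr
  · have hclose := hsel _ hbox _ fun b i => (abs_pathProps_nuisStat_sub_le
      (fun b i => hpos (some (b, i))) hleaf (fun b i => hω (some (b, i))) hu b i).trans_eq
      (mul_div_cancel₀ δ three_ne_zero)
    have hmem := (mem_statDomain_iff (t n) (X n)).2 hclose.1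
    exact ⟨hmem, prod_lambda_eq_selectionProb (t n) (X n) I ε hmem ▸ hclose.2⟩
  · have hvar : π n 0 * (1 - π n 0) / (δ / 3 * √(count (X n) ((t n).leaf 0))) ^ 2 ≤ c * κ / 4 := by
      rw [mul_pow, Real.sq_sqrt (Nat.cast_nonneg _), div_le_iff₀ (by positivity), ← mul_assoc]
      exact (mul_le_one₀ hp.2.le (sub_nonneg.2 hp.2.le) (sub_le_self 1 hp.1.le)).trans hN
    calc 2 * (c * κ / 4 + π n 0 * (1 - π n 0) / (δ / 3 * √(count (X n) ((t n).leaf 0))) ^ 2) /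
          meanSelectionProb I ε (t n) (X n) (π n)
        ≤ 2 * (c * κ / 4 + c * κ / 4) / c := by
          gcongr
          exact hw.1
      _ = κ := by field_simp; ring

end Asymptotics

section MainStatistic

variable {𝒳 : Type*} {X : (n : ℕ) → Fin n → 𝒳} {Ω : ℕ → Type*} [∀ n, MeasurableSpace (Ω n)]
  {P : (n : ℕ) → Measure (Ω n)} [∀ n, IsProbabilityMeasure (P n)]
  {Y : (n : ℕ) → Fin n → Ω n → Bool}

lemma sum_ite_sub_div_sqrt {n : ℕ} (X : Fin n → 𝒳) (y : Fin n → Bool) (R : Set 𝒳) (p v : ℝ) :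
    ∑ i ∈ samplesIn X R, ((if y i then (1 : ℝ) else 0) - p) / √(count X R * v) =
      √(count X R) * (prop X y R - p) / √v := by
  rw [← Finset.sum_div, Finset.sum_sub_distrib, Finset.sum_const, card_samplesIn, nsmul_eq_mul,
    ← count_mul_prop, ← mul_sub, Real.sqrt_mul (Nat.cast_nonneg _), ← div_div, mul_div_right_comm,
    Real.div_sqrt]

lemma tendstoInDistribution_sqrt_count_mul_prop_sub {R : ℕ → Set 𝒳} {p : ℕ → ℝ}
    (hp : ∀ n, p n ∈ Set.Icc (0 : ℝ) 1) (hYm : ∀ n i, Measurable (Y n i))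
    (hYind : ∀ n, iIndepFun (Y n) (P n))
    (hYlaw : ∀ n, ∀ i ∈ samplesIn (X n) (R n),
      P n {ω | Y n i ω = true} = ENNReal.ofReal (p n))
    (hvar : Tendsto (fun n => count (X n) (R n) * (p n * (1 - p n))) atTop atTop) :
    TendstoInDistribution (fun n ω => √(count (X n) (R n)) *
      (prop (X n) (fun i => Y n i ω) (R n) - p n) / √(p n * (1 - p n))) atTop (fun x : ℝ => x) P
      (gaussianReal 0 1) := by
  simp only [← sum_ite_sub_div_sqrt]
  have hYm' (n : ℕ) (i : Fin n) := measurable_ite_one_zero (hYm n i)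
  refine tendstoInDistribution_sum_of_abs_le
    (b := fun n => 1 / √(count (X n) (R n) * (p n * (1 - p n))))
    (fun n i => (((hYm' n i).sub_const _).div_const _).aemeasurable)
    (fun n => (hYind n).comp (fun _ b => ((if b then (1 : ℝ) else 0) - p n) / _)
      fun _ => measurable_of_countable _)
    (fun n i hi => ?_) (fun n i _ => .of_forall fun ω => ?_)
    ((Real.tendsto_sqrt_atTop.comp hvar).const_div_atTop 1) ?_
  · have hint : Integrable (fun ω => if Y n i ω then (1 : ℝ) else 0) (P n) :=
      .of_bound (hYm' n i).aestronglyMeasurable 1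
        (.of_forall fun ω => by split_ifs <;> simp)
    rw [integral_div, integral_sub hint (integrable_const _),
      integral_ite_one_zero (hYm n i) (hp n).1 (hYlaw n i hi)]
    simp
  · rw [abs_div, abs_of_nonneg (Real.sqrt_nonneg _)]
    gcongr
    exact Real.dist_le_of_mem_Icc_01 (ite_one_zero_mem_Icc _) (hp n)
  · filter_upwards [hvar.eventually_gt_atTop 0] with n hn
    have hvarZ : ∀ i ∈ samplesIn (X n) (R n), Var[fun ω => ((if Y n i ω then (1 : ℝ) else 0) -
        p n) / √(count (X n) (R n) * (p n * (1 - p n))); P n] = (count (X n) (R n) : ℝ)⁻¹ := by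
      intro i hi
      simp only [div_eq_mul_inv, variance_mul_const]
      rw [variance_sub_const (hYm' n i).aestronglyMeasurable,
        variance_ite_one_zero (hYm n i) (hp n).1 (hYlaw n i hi), inv_pow, Real.sq_sqrt hn.le]
      rw [← div_eq_mul_inv, div_mul_cancel_right₀ (right_ne_zero_of_mul hn.ne')]
    rw [Finset.sum_congr rfl hvarZ, Finset.sum_const, card_samplesIn, nsmul_eq_mul,
      mul_inv_cancel₀ (left_ne_zero_of_mul hn.ne')]

variable {d m : ℕ} {k : Fin d → ℕ} [NeZero m] [∀ h, NeZero (k h)]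
  {t : ℕ → TreeFit 𝒳 d m k} {π : ℕ → Fin m → ℝ}

lemma tendstoInDistribution_cdf_mainStat (hπ : ∀ n j, π n j ∈ Set.Ioo (0 : ℝ) 1)
    (hYm : ∀ n i, Measurable (Y n i)) (hYind : ∀ n, iIndepFun (Y n) (P n))
    (hYlaw : ∀ n i, P n {ω | Y n i ω = true} = ENNReal.ofReal ((t n).theta (π n) (X n i)))
    (hcount : Tendsto (fun n => count (X n) ((t n).leaf 0)) atTop atTop) {a : ℝ} (ha : 0 < a)
    (hπa : ∀ᶠ n in atTop, ∀ j, π n j ∈ Set.Icc a (1 - a)) :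
    TendstoInDistribution (fun n ω => cdf (gaussianReal (√(count (X n) ((t n).leaf 0)) * π n 0)
      (π n 0 * (1 - π n 0)).toNNReal) (mainStat (t n) (X n) fun i => Y n i ω)) atTop
      (fun x : ℝ => x) P uniformLaw := by
  have hvar (n : ℕ) : 0 < π n 0 * (1 - π n 0) := mul_pos (hπ n 0).1 (sub_pos.2 (hπ n 0).2)
  have hlarge : Tendsto (fun n => count (X n) ((t n).leaf 0) * (π n 0 * (1 - π n 0))) atTop
      atTop := by
    refine tendsto_atTop_mono' _ ?_ ((tendsto_natCast_atTop_atTop.comp hcount).atTop_mul_const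
      (mul_pos ha ha))
    filter_upwards [hπa] with n hn
    exact mul_le_mul_of_nonneg_left (mul_le_mul (hn 0).1 (by linarith [(hn 0).2]) ha.le
      (hπ n 0).1.le) (Nat.cast_nonneg _)
  have : NullSingletonClass (gaussianReal 0 1) := nullSingletonClass_gaussianReal one_ne_zero
  have hclt := tendstoInDistribution_cdf (gaussianReal 0 1)
    (tendstoInDistribution_sqrt_count_mul_prop_sub (p := fun n => π n 0)
      (fun n => Set.Ioo_subset_Icc_self (hπ n 0)) hYm hYind
      (fun n i hi => (t n).theta_eq (π n) ((mem_samplesIn _).1 hi) ▸ hYlaw n i) hlarge)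
  simpa only [cdf_gaussianReal _ (Real.toNNReal_pos.2 (hvar _)).ne', mainStat, ← mul_sub,
    Real.coe_toNNReal _ (hvar _).le] using hclt

lemma tendstoInDistribution_pivot {I : ℝ → ℝ} (ε : Fin d → ℝ)
    (hI : ContinuousOn I (Set.Ioo 0 1)) (hπ : ∀ n j, π n j ∈ Set.Ioo (0 : ℝ) 1)
    (hYm : ∀ n i, Measurable (Y n i)) (hYind : ∀ n, iIndepFun (Y n) (P n))
    (hYlaw : ∀ n i, P n {ω | Y n i ω = true} = ENNReal.ofReal ((t n).theta (π n) (X n i)))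
    (hcount : ∀ r, Tendsto (fun n => count (X n) ((t n).pathRegion r)) atTop atTop) {a : ℝ}
    (ha : 0 < a) (hπa : ∀ᶠ n in atTop, ∀ j, π n j ∈ Set.Icc a (1 - a)) :
    TendstoInDistribution (fun n ω => pivot I ε (t n) (X n) (π n 0) fun i => Y n i ω) atTop
      (fun x : ℝ => x) P uniformLaw := by
  have hdev (r : Option (NuisIdx k × Fin 3)) : TendstoZeroInProbability P (fun n ω =>
      prop (X n) (fun i => Y n i ω) ((t n).pathRegion r) - pathMean (t n) (X n) (π n) r) atTop :=
    tendstoZeroInProbability_prop_sub_pathMean (fun n j => (hπ n j).1.le) hYm hYind hYlaw (hcount r)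
  have hm (n : ℕ) :
      AEMeasurable (fun ω => pivot I ε (t n) (X n) (π n 0) fun i => Y n i ω) (P n) :=
    ((measurable_of_countable (pivot I ε (t n) (X n) (π n 0))).comp
      (measurable_pi_lambda _ (hYm n))).aemeasurable
  refine tendstoInDistribution_of_tendstoZeroInProbability_dist
    (tendstoInDistribution_cdf_mainStat hπ hYm hYind hYlaw (hcount none) ha hπa) hm ?_
  simp only [Real.dist_eq]
  exact (tendstoZeroInProbability_pivot_sub_cdf ε hI ha hπa hcount hdev).of_abs_le_mul zero_le_one
    fun n ω => by rw [abs_abs, one_mul]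

end MainStatistic

section FiniteConditioning

variable {Ω β : Type*} [MeasurableSpace Ω] {P : Measure Ω} [Finite β] {Y : Ω → β} {A : Set Ω}
  {w : β → ℝ}

lemma measure_preimage_inter_eq_mul_ofReal_prod {ι κ γ : Type*} [Fintype κ] {Y : ι → Ω → γ}
    {y : ι → γ} {p : κ → ℝ} (hp : ∀ h, 0 ≤ p h) (h : P {ω | (∀ i, Y i ω = y i) ∧ ω ∈ A} =
      P {ω | ∀ i, Y i ω = y i} * ∏ h, ENNReal.ofReal (p h)) :
    P ((fun ω i => Y i ω) ⁻¹' {y} ∩ A) =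
      P ((fun ω i => Y i ω) ⁻¹' {y}) * ENNReal.ofReal (∏ h, p h) := by
  have hpre : (fun ω i => Y i ω) ⁻¹' {y} = {ω | ∀ i, Y i ω = y i} := by
    ext ω
    simp [funext_iff]
  rw [hpre, ENNReal.ofReal_prod_of_nonneg fun h _ => hp h]
  exact h

lemma measure_ne_zero_of_measure_inter_eq_mul [NeZero P] (hw : ∀ b, 0 < w b)
    (h : ∀ b, P (Y ⁻¹' {b} ∩ A) = P (Y ⁻¹' {b}) * ENNReal.ofReal (w b)) : P A ≠ 0 := by
  intro hA
  have hY (b : β) : P (Y ⁻¹' {b}) = 0 := by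
    have hb := (h b).symm.trans (measure_mono_null Set.inter_subset_right hA)
    exact (mul_eq_zero.1 hb).resolve_right (ENNReal.ofReal_pos.2 (hw b)).ne'
  have hcover : Set.univ = ⋃ b, Y ⁻¹' {b} := by ext ω; simp
  exact NeZero.ne P (Measure.measure_univ_eq_zero.1 (hcover ▸ measure_iUnion_null hY))

lemma setIntegral_comp_eq_integral_mul [IsFiniteMeasure P] [MeasurableSpace β]
    [MeasurableSingletonClass β] (hY : Measurable Y) (hw : ∀ b, 0 ≤ w b)
    (h : ∀ b, P (Y ⁻¹' {b} ∩ A) = P (Y ⁻¹' {b}) * ENNReal.ofReal (w b)) (g : β → ℝ) :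
    ∫ ω in A, g (Y ω) ∂P = ∫ ω, g (Y ω) * w (Y ω) ∂P := by
  have := Fintype.ofFinite β
  rw [← integral_map (φ := Y) (f := g) hY.aemeasurable .of_discrete,
    ← integral_map (φ := Y) (f := fun b => g b * w b) hY.aemeasurable .of_discrete,
    integral_fintype .of_finite, integral_fintype .of_finite]
  refine Finset.sum_congr rfl fun b _ => ?_
  have hb := measurableSet_singleton b
  rw [map_measureReal_apply hY hb, map_measureReal_apply hY hb,
    measureReal_restrict_apply (hY hb), measureReal_def, h b, ENNReal.toReal_mul,
    ENNReal.toReal_ofReal (hw b), ← measureReal_def, smul_eq_mul, smul_eq_mul, mul_right_comm,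
    mul_assoc]

end FiniteConditioning

section Assumptions

lemma tendsto_atTop_of_limsup_div_lt_top {c : ℕ → ℕ}
    (h : limsup (fun n : ℕ => (n : ℝ≥0∞) / (c n : ℝ≥0∞)) atTop < ∞) : Tendsto c atTop atTop := by
  obtain ⟨r, hr⟩ := ENNReal.lt_iff_exists_nnreal_btwn.1 h
  obtain ⟨B, hB⟩ := exists_nat_gt r
  have hle : ∀ᶠ n in atTop, n ≤ B * c n := by
    filter_upwards [eventually_lt_of_limsup_lt hr.1] with n hn
    have hnB : (n : ℝ≥0∞) / c n ≤ B := (hn.trans (by exact_mod_cast hB)).le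
    exact_mod_cast (ENNReal.div_le_iff_le_mul (by simp) (by simp)).1 hnB
  refine tendsto_atTop.2 fun M => ?_
  filter_upwards [hle, eventually_gt_atTop (B * M)] with n hn hM
  exact (lt_of_mul_lt_mul_left (hM.trans_le hn) (Nat.zero_le B)).le

lemma BoundedThriceDiff.continuousOn {I : ℝ → ℝ} (hI : BoundedThriceDiff I) :
    ContinuousOn I (Set.Ioo 0 1) :=
  (iteratedDeriv_zero (f := I) ▸ hI.1 0 three_pos).continuousOn

lemma exists_eventually_mem_Icc {ι : Type*} [Finite ι] {π : ℕ → ι → ℝ}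
    (hπ : ∀ n j, π n j ∈ Set.Icc (0 : ℝ) 1) (hπ0 : ∀ j, 0 < liminf (fun n => π n j) atTop)
    (hπ1 : ∀ j, limsup (fun n => π n j) atTop < 1) :
    ∃ a > 0, ∀ᶠ n in atTop, ∀ j, π n j ∈ Set.Icc a (1 - a) := by
  have hsmall (j : ι) : ∀ᶠ a in 𝓝[>] (0 : ℝ), ∀ᶠ n in atTop, π n j ∈ Set.Icc a (1 - a) := by
    filter_upwards [nhdsWithin_le_nhds (eventually_lt_nhds (hπ0 j)),
      nhdsWithin_le_nhds (eventually_lt_nhds (sub_pos.2 (hπ1 j)))] with a ha0 ha1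
    filter_upwards [eventually_lt_of_lt_liminf ha0 (isBoundedUnder_of ⟨0, fun n => (hπ n j).1⟩),
      eventually_lt_of_limsup_lt (lt_sub_comm.1 ha1)
        (isBoundedUnder_of ⟨1, fun n => (hπ n j).2⟩)] with n hn0 hn1
    exact ⟨hn0.le, hn1.le⟩
  obtain ⟨a, ha, ha0⟩ := ((eventually_all.2 hsmall).and self_mem_nhdsWithin).exists
  exact ⟨a, ha0, eventually_all.2 ha⟩

variable {𝒳 : Type*} {d m : ℕ} {k : Fin d → ℕ} [NeZero m] [∀ h, NeZero (k h)]
  {X : (n : ℕ) → Fin n → 𝒳} {t : ℕ → TreeFit 𝒳 d m k}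

lemma tendsto_count_pathRegion
    (hleaf : Tendsto (fun n => count (X n) ((t n).leaf 0)) atTop atTop)
    (hchild : ∀ h j, Tendsto (fun n => count (X n) ((t n).child h j)) atTop atTop)
    (hcompl : ∀ h j,
      Tendsto (fun n => count (X n) ((t n).node h.castSucc \ (t n).child h j)) atTop atTop) :
    ∀ r, Tendsto (fun n => count (X n) ((t n).pathRegion r)) atTop atTop
  | none => hleaf
  | some (b, 0) => tendsto_atTop_mono (fun n => count_mono (X n) ((t n).child_subset b.1 b.2))
      (hchild b.1 b.2)
  | some (b, 1) => hchild b.1 b.2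
  | some (b, 2) => hcompl b.1 b.2

end Assumptions

end ExpTree

end

theorem theorem1_general
    {𝒳 : Type*} {d m : ℕ} {k : Fin d → ℕ} [NeZero m] [∀ h, NeZero (k h)]
    (I : ℝ → ℝ) (ε : Fin d → ℝ)
    (X : (n : ℕ) → Fin n → 𝒳) (t : ℕ → ExpTree.TreeFit 𝒳 d m k) (π : ℕ → Fin m → ℝ)
    (hπ : ∀ n j, π n j ∈ Set.Ioo (0 : ℝ) 1)
    {Ω : ℕ → Type*} [∀ n, MeasurableSpace (Ω n)] (P : (n : ℕ) → Measure (Ω n))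
    [∀ n, IsProbabilityMeasure (P n)]
    (Y : (n : ℕ) → Fin n → Ω n → Bool) (S : (n : ℕ) → (h : Fin d) → Ω n → Fin (k h))
    (hYm : ∀ n i, Measurable (Y n i)) (hYind : ∀ n, iIndepFun (Y n) (P n))
    (hYlaw : ∀ n i, P n {ω | Y n i ω = true} = ENNReal.ofReal ((t n).theta (π n) (X n i)))
    (hS : ∀ n (y : Fin n → Bool) (s : (h : Fin d) → Fin (k h)),
      P n {ω | (∀ i, Y n i ω = y i) ∧ ∀ h, S n h ω = s h} =
        P n {ω | ∀ i, Y n i ω = y i} *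
          ∏ h, ENNReal.ofReal (ExpTree.splitProb I (ε h) (X n) y ((t n).node h.castSucc)
            ((t n).child h) (s h)))
    (hleaf : Tendsto (fun n => ExpTree.count (X n) ((t n).leaf 0)) atTop atTop)
    (hchild : ∀ h j, Tendsto (fun n => ExpTree.count (X n) ((t n).child h j)) atTop atTop)
    (hcompl : ∀ h j, Tendsto (fun n =>
      ExpTree.count (X n) ((t n).node h.castSucc \ (t n).child h j)) atTop atTop)
    (hπ0 : ∀ j, 0 < liminf (fun n => π n j) atTop)
    (hπ1 : ∀ j, limsup (fun n => π n j) atTop < 1)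
    (hI : ContinuousOn I (Set.Ioo 0 1)) :
    ∃ _ : ∀ n, IsProbabilityMeasure ((P n)[|{ω | ∀ h, S n h ω = 0}]),
      TendstoInDistribution
        (fun n ω => ExpTree.pivot I ε (t n) (X n) (π n 0) (fun i => Y n i ω)) atTop
        (fun x : ℝ => x) (fun n => (P n)[|{ω | ∀ h, S n h ω = 0}])
        ExpTree.uniformLaw := by
  have hprob (n : ℕ) (y : Fin n → Bool) := ExpTree.observedProb_mem_Ioc (t n) (X n) y I ε
  have hlaw (n : ℕ) (y : Fin n → Bool) :
      P n ((fun ω i => Y n i ω) ⁻¹' {y} ∩ {ω | ∀ h, S n h ω = 0}) =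
        P n ((fun ω i => Y n i ω) ⁻¹' {y}) *
          ENNReal.ofReal (ExpTree.observedProb I ε (t n) (X n) y) :=
    ExpTree.measure_preimage_inter_eq_mul_ofReal_prod
      (fun h => (ExpTree.splitProb_mem_Ioc _ _ _ _ _ _ _).1.le) (hS n y 0)
  have hcond (n : ℕ) : IsProbabilityMeasure ((P n)[|{ω | ∀ h, S n h ω = 0}]) :=
    cond_isProbabilityMeasure
      (ExpTree.measure_ne_zero_of_measure_inter_eq_mul (fun y => (hprob n y).1) (hlaw n))
  obtain ⟨a, ha, hπa⟩ :=
    ExpTree.exists_eventually_mem_Icc (fun n j => Set.Ioo_subset_Icc_self (hπ n j)) hπ0 hπ1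
  have hcount := ExpTree.tendsto_count_pathRegion hleaf hchild hcompl
  have hdev (r) := ExpTree.tendstoZeroInProbability_prop_sub_pathMean (fun n j => (hπ n j).1.le)
    hYm hYind hYlaw (hcount r)
  obtain ⟨c, hc, hw⟩ := ExpTree.exists_eventually_meanSelectionProb_mem_Icc ε hI ha hπa hcount
  have hpivot := ExpTree.tendstoInDistribution_pivot ε hI hπ hYm hYind hYlaw hcount ha hπa
  have hYm' (n : ℕ) : Measurable fun ω i => Y n i ω := measurable_pi_lambda _ (hYm n)
  have hset (n : ℕ) (f : ℝ → ℝ) := ExpTree.setIntegral_comp_eq_integral_mul (hYm' n)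
    (fun y => (hprob n y).1.le) (hlaw n) fun y => f (ExpTree.pivot I ε (t n) (X n) (π n 0) y)
  have hprobm (n : ℕ) :
      AEMeasurable (fun ω => ExpTree.observedProb I ε (t n) (X n) fun i => Y n i ω) (P n) :=
    ((measurable_of_countable (ExpTree.observedProb I ε (t n) (X n))).comp (hYm' n)).aemeasurable
  exact ⟨hcond, ExpTree.tendstoInDistribution_cond_of_tendstoZeroInProbability hpivot hprobm
    (fun n ω => Set.Ioc_subset_Icc_self (hprob n _)) hc hw
    (ExpTree.tendstoZeroInProbability_observedProb_sub ε hI ha hπa hcount hdev) hset⟩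

theorem theorem1
    {𝒳 : Type*} {d m : ℕ} {k : Fin d → ℕ} [NeZero m] [∀ h, NeZero (k h)]
    -- impurity function and temperature parameters
    (I : ℝ → ℝ) (ε : Fin d → ℝ)
    -- for every sample size `n`: predictors, observed tree fit, means of the leaves
    (X : (n : ℕ) → Fin n → 𝒳) (t : ℕ → ExpTree.TreeFit 𝒳 d m k) (π : ℕ → Fin m → ℝ)
    (hπ : ∀ n j, π n j ∈ Set.Ioo (0 : ℝ) 1)
    -- for every sample size `n`: a probability space with the outcomes and the random splits
    {Ω : ℕ → Type*} [∀ n, MeasurableSpace (Ω n)] (P : (n : ℕ) → Measure (Ω n))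
    [∀ n, IsProbabilityMeasure (P n)]
    (Y : (n : ℕ) → Fin n → Ω n → Bool) (S : (n : ℕ) → (h : Fin d) → Ω n → Fin (k h))
    (hYm : ∀ n i, Measurable (Y n i)) (hSm : ∀ n h, Measurable (S n h))
    -- the outcomes are independent Bernoulli variables
    (hYind : ∀ n, iIndepFun (Y n) (P n))
    (hYlaw : ∀ n i, P n {ω | Y n i ω = true} = ENNReal.ofReal ((t n).theta (π n) (X n i)))
    -- given the outcomes, the splits are drawn independently by the exponential mechanism
    (hS : ∀ n (y : Fin n → Bool) (s : (h : Fin d) → Fin (k h)),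
      P n {ω | (∀ i, Y n i ω = y i) ∧ ∀ h, S n h ω = s h} =
        P n {ω | ∀ i, Y n i ω = y i} *
          ∏ h, ENNReal.ofReal (ExpTree.splitProb I (ε h) (X n) y ((t n).node h.castSucc)
            ((t n).child h) (s h)))
    -- the numbers of samples in all relevant regions grow proportionally with `n`
    (hleaf : limsup (fun n : ℕ => (n : ℝ≥0∞) / (ExpTree.count (X n) ((t n).leaf 0) : ℝ≥0∞)) atTop < ∞)
    (hchild : ∀ h j,
      limsup (fun n : ℕ => (n : ℝ≥0∞) / (ExpTree.count (X n) ((t n).child h j) : ℝ≥0∞)) atTop < ∞)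
    (hcompl : ∀ h j,
      limsup (fun n : ℕ => (n : ℝ≥0∞) /
        (ExpTree.count (X n) ((t n).node h.castSucc \ (t n).child h j) : ℝ≥0∞)) atTop < ∞)
    -- the means of the leaves stay away from `0` and `1`
    (hπ0 : ∀ j, 0 < liminf (fun n => π n j) atTop)
    (hπ1 : ∀ j, limsup (fun n => π n j) atTop < 1)
    -- the eigenvalues of the covariance matrix stay away from `0` and `∞`
    (hcov : ∃ b B : ℝ, 0 < b ∧ 0 < B ∧ ∀ᶠ n in atTop,
      (ExpTree.covMatrix (t n) (X n) (Y n) (P n)).PosDef ∧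
        ∀ x ∈ spectrum ℝ (ExpTree.covMatrix (t n) (X n) (Y n) (P n)), 1 / b ^ 2 < x ∧ x < B ^ 2)
    -- regularity of the impurity function
    (hI : ExpTree.BoundedThriceDiff I) :
    ∃ _ : ∀ n, IsProbabilityMeasure ((P n)[|{ω | ∀ h, S n h ω = 0}]),
      TendstoInDistribution
        (fun n ω => ExpTree.pivot I ε (t n) (X n) (π n 0) (fun i => Y n i ω)) atTop
        (fun x : ℝ => x) (fun n => (P n)[|{ω | ∀ h, S n h ω = 0}])
        ExpTree.uniformLaw := by
  exact theorem1_general I ε X t π hπ P Y S hYm hYind hYlaw hS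
    (ExpTree.tendsto_atTop_of_limsup_div_lt_top hleaf)
    (fun h j => ExpTree.tendsto_atTop_of_limsup_div_lt_top (hchild h j))
    (fun h j => ExpTree.tendsto_atTop_of_limsup_div_lt_top (hcompl h j)) hπ0 hπ1 hI.continuousOn
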